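/- Let $n\ge 3$ and $m\ge 2$ be integers, let $g$ be the Riemannian metric on the unit sphere $\mathbb S^n\subset\mathbb R^{n+1}$ inherited from $\mathbb R^{n+1}$, with geodesic distance $d_g$, gradient $\nabla_g$ and volume $\mathrm dv_g$, and let $\mathbb S^n_+=\{y\in\mathbb S^n: y_{n+1}>0\}$ be the open upper hemisphere. Let $H^1_g(\mathbb S^n_+)$ be the completion of $C_0^\infty(\mathbb S^n_+)$ with respect to the norm $\big(\|u\|_{L^2}^2+\|\nabla_g u\|_{L^2}^2\big)^{1/2}$. Let $x_1,\dots,x_m\in\mathbb S^n_+$ be pairwise distinct points, write $d_i=d_g(\cdot,x_i)$, and let $\beta=\max_{1\le i\le m}d_g(x_0,x_i)$, where $x_0=(0,\dots,0,1)$ is the north pole. Put $$C(n,\beta)=(n-1)(n-2)\,\frac{7\pi^2-3\left(\beta+\frac{\pi}{2}\right)^2}{2\pi^2\left(\pi^2-\left(\beta+\frac{\pi}{2}\right)^2\right)}.$$ Then for every $u\in H^1_g(\mathbb S^n_+)$ the integrals on the right-hand side below are finite, and $$\int_{\mathbb S^n_+}|\nabla_g u|^2\,\mathrm dv_g+C(n,\beta)\int_{\mathbb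 S^n_+}u^2\,\mathrm dv_g\;\ge\;\frac{(n-2)^2}{m^2}\sum_{1\le i<j\le m}\int_{\mathbb S^n_+}\left|\frac{\nabla_g d_i}{d_i}-\frac{\nabla_g d_j}{d_j}\right|^2u^2\,\mathrm dv_g .$$ -/

import Mathlib

open MeasureTheory Filter Topology
open scoped Manifold ContDiff Bundle

namespace MultipolarHardy

noncomputable section

/-- The Euclidean space `ℝⁿ⁺¹`. -/
abbrev Ambient (n : ℕ) : Type := EuclideanSpace ℝ (Fin (n + 1))

instance (n : ℕ) : Fact (Module.finrank ℝ (Ambient n) = n + 1) :=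
  ⟨by simp⟩

/-- The unit sphere `𝕊ⁿ ⊂ ℝⁿ⁺¹`, with Mathlib's smooth structure (modelled on `𝓡 n`). -/
abbrev UnitSphere (n : ℕ) : Type := Metric.sphere (0 : Ambient n) 1

/-- The differential at `x` of the inclusion `𝕊ⁿ → ℝⁿ⁺¹`. -/
def inclDeriv (n : ℕ) (x : UnitSphere n) : TangentSpace (𝓡 n) x →L[ℝ] Ambient n :=
  mvfderiv (𝓡 n) ((↑) : UnitSphere n → Ambient n) x

theorem inclDeriv_injective (n : ℕ) (x : UnitSphere n) :
    Function.Injective (inclDeriv n x) :=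
  injective_mvfderiv_subtypeVal_sphere x

/-- The bilinear form `(v, w) ↦ ⟨dι v, dι w⟩` on the tangent space at `x`, where `ι` is the
inclusion `𝕊ⁿ → ℝⁿ⁺¹`. -/
def inheritedInner (n : ℕ) (x : UnitSphere n) :
    TangentSpace (𝓡 n) x →L[ℝ] TangentSpace (𝓡 n) x →L[ℝ] ℝ :=
  let L : EuclideanSpace ℝ (Fin n) →L[ℝ] Ambient n := inclDeriv n x
  (innerSL ℝ (E := Ambient n) : Ambient n →L[ℝ] Ambient n →L[ℝ] ℝ).bilinearComp L L

theorem inheritedInner_apply (n : ℕ) (x : UnitSphere n) (v w : TangentSpace (𝓡 n) x) :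
    inheritedInner n x v w = inner ℝ (inclDeriv n x v) (inclDeriv n x w) :=
  rfl

/-- The Riemannian metric of `𝕊ⁿ` inherited from `ℝⁿ⁺¹`: the pull-back of the Euclidean inner
product under the differential of the inclusion. -/
def inheritedMetric (n : ℕ) :
    Bundle.RiemannianMetric (fun x : UnitSphere n => TangentSpace (𝓡 n) x) where
  inner x := inheritedInner n x
  symm x v w := by
    simp only [inheritedInner_apply, real_inner_comm]
  pos x v hv := by
    have h : inclDeriv n x v ≠ 0 := fun h0 =>
      hv (inclDeriv_injective n x (by rw [h0, map_zero]))
    simpa only [inheritedInner_apply] using real_inner_self_pos.2 h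
  continuousAt x := by
    have h : Continuous fun v : TangentSpace (𝓡 n) x =>
        inner ℝ (inclDeriv n x v) (inclDeriv n x v) :=
      (inclDeriv n x).continuous.inner (inclDeriv n x).continuous
    simpa only [inheritedInner_apply] using h.continuousAt
  isVonNBounded x := by
    let L : EuclideanSpace ℝ (Fin n) →L[ℝ] Ambient n := inclDeriv n x
    have hL : Function.Injective L := inclDeriv_injective n x
    obtain ⟨K, hK, hanti⟩ :=
      (L : EuclideanSpace ℝ (Fin n) →ₗ[ℝ] Ambient n).exists_antilipschitzWith
        (LinearMap.ker_eq_bot.2 hL)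
    change Bornology.IsVonNBounded ℝ
      {v : EuclideanSpace ℝ (Fin n) | inner ℝ (L v) (L v) < 1}
    refine (NormedSpace.isVonNBounded_ball ℝ (EuclideanSpace ℝ (Fin n)) (K + 1)).subset ?_
    intro v hv
    have hv1 : ‖L v‖ < 1 := by
      have h2 : inner ℝ (L v) (L v) < 1 := hv
      rw [real_inner_self_eq_norm_sq] at h2
      nlinarith [norm_nonneg (L v)]
    have hv2 : ‖v‖ ≤ K * ‖L v‖ := by
      simpa using hanti.le_mul_norm_sub v 0
    have hK0 : (0 : ℝ) ≤ K := K.2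
    have hv3 : ‖v‖ < K + 1 := by nlinarith
    simpa using hv3

instance (n : ℕ) : Bundle.RiemannianBundle (fun x : UnitSphere n => TangentSpace (𝓡 n) x) :=
  ⟨inheritedMetric n⟩

/-- The Riemannian norm of a tangent vector is its Euclidean norm in `ℝⁿ⁺¹`. -/
theorem norm_inclDeriv (n : ℕ) (x : UnitSphere n) (v : TangentSpace (𝓡 n) x) :
    ‖inclDeriv n x v‖ = ‖v‖ := by
  rw [norm_eq_sqrt_real_inner, norm_eq_sqrt_real_inner]
  rfl

instance (n : ℕ) (x : UnitSphere n) : FiniteDimensional ℝ (TangentSpace (𝓡 n) x) :=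
  inferInstanceAs (FiniteDimensional ℝ (EuclideanSpace ℝ (Fin n)))

instance (n : ℕ) (x : UnitSphere n) : CompleteSpace (TangentSpace (𝓡 n) x) :=
  FiniteDimensional.complete ℝ _

/-- The geodesic distance `d_g(x, y)` of `𝕊ⁿ`: the infimum of the lengths, with respect to the
inherited Riemannian metric, of the `C¹` paths on `𝕊ⁿ` from `x` to `y`. -/
def geodDist (n : ℕ) (x y : UnitSphere n) : ℝ :=
  (Manifold.riemannianEDist (𝓡 n) x y).toReal

/-- The canonical Riemannian volume `v_g` of `𝕊ⁿ`, i.e. its surface measure. -/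
def sphereVolume (n : ℕ) : Measure (UnitSphere n) :=
  (volume : Measure (Ambient n)).toSphere

/-- The Riemannian gradient: the tangent vector that represents the differential of `f` at `x`
with respect to the inherited metric. -/
def tangentGrad (n : ℕ) (f : UnitSphere n → ℝ) (x : UnitSphere n) : TangentSpace (𝓡 n) x :=
  (InnerProductSpace.toDual ℝ (TangentSpace (𝓡 n) x)).symm (mvfderiv (𝓡 n) f x)

/-- The Riemannian gradient `∇_g f(x)`, seen as a vector of `ℝⁿ⁺¹`. As the metric is inherited
from `ℝⁿ⁺¹`, its Riemannian norm is its Euclidean norm. -/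
def grad (n : ℕ) (f : UnitSphere n → ℝ) (x : UnitSphere n) : Ambient n :=
  inclDeriv n x (tangentGrad n f x)

/-- The north pole `(0, …, 0, 1)`. -/
def northPole (n : ℕ) : UnitSphere n :=
  ⟨EuclideanSpace.single (Fin.last n) 1, by simp⟩

/-- The open upper hemisphere. -/
def upperHemisphere (n : ℕ) : Set (UnitSphere n) :=
  {y | 0 < (y : Ambient n) (Fin.last n)}

/-- The restriction of `v_g` to the open upper hemisphere. -/
def hemisphereVolume (n : ℕ) : Measure (UnitSphere n) :=
  (sphereVolume n).restrict (upperHemisphere n)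

/-- `C₀^∞` of the open upper hemisphere; a function in it is extended by `0` to the sphere. (The
closed support is compact, the sphere being compact.) -/
def IsTestFunction (n : ℕ) (φ : UnitSphere n → ℝ) : Prop :=
  ContMDiff (𝓡 n) 𝓘(ℝ, ℝ) ∞ φ ∧ tsupport φ ⊆ upperHemisphere n

/-- `u` belongs to `H¹_g` of the open upper hemisphere, with gradient `V`. The space `H¹_g` is the
completion of `C₀^∞` for the norm `(‖u‖²_{L²} + ‖∇_g u‖²_{L²})^{1/2}`; it is realized here as the
closure of `{(φ, ∇_g φ)}` in `L² × L²`. -/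
def MemSobolev (n : ℕ) (u : UnitSphere n → ℝ) (V : UnitSphere n → Ambient n) : Prop :=
  MemLp u 2 (hemisphereVolume n) ∧ MemLp V 2 (hemisphereVolume n) ∧
    ∃ φ : ℕ → UnitSphere n → ℝ, (∀ k, IsTestFunction n (φ k)) ∧
      Tendsto (fun k => eLpNorm (φ k - u) 2 (hemisphereVolume n)) atTop (𝓝 0) ∧
      Tendsto (fun k => eLpNorm (grad n (φ k) - V) 2 (hemisphereVolume n)) atTop (𝓝 0)

/-- `|∇_g d_p / d_p - ∇_g d_q / d_q|²` at `y`, where `d_p = d_g(·, p)`. -/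
def bipolarPotential (n : ℕ) (p q y : UnitSphere n) : ℝ :=
  ‖(geodDist n y p)⁻¹ • grad n (fun z => geodDist n z p) y -
    (geodDist n y q)⁻¹ • grad n (fun z => geodDist n z q) y‖ ^ 2

/-- The constant `C(n, β)`. -/
def hardyConst (n : ℕ) (β : ℝ) : ℝ :=
  ((n : ℝ) - 1) * ((n : ℝ) - 2) *
    ((7 * Real.pi ^ 2 - 3 * (β + Real.pi / 2) ^ 2) /
      (2 * Real.pi ^ 2 * (Real.pi ^ 2 - (β + Real.pi / 2) ^ 2)))

end

end MultipolarHardy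

/-! The core is completion of a square. For a test function φ put Y_i = -φ ∇d_i/d_i and c = (n-2)/m.
Expanding 0 ≤ |∇φ - c Σ Y_i|² and using the identity |Σ Y_i|² + Σ_{i<j} |Y_i - Y_j|² = m Σ |Y_i|²
(`norm_sum_sq_add_sum_norm_sub_sq`) gives c² Σ_{i<j} |Y_i - Y_j|² ≤ |∇φ|² - c Σ_i (2⟨∇φ, Y_i⟩ -
(n-2)|Y_i|²). It remains to bound the integral of each bracket from below by a multiple of -∫ φ².

With s = ⟨y, p⟩ = cos θ one has d = θ and Y = φ h(s) ∇s, where h = 1/(θ sin θ). The divergence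
theorem for ∇s, whose divergence is -n s (`integral_inner_grad`), turns the integral of the bracket
into that of φ² (n s h - h'(1-s²) - (n-2) h² (1-s²)), which for this h equals (n-1) φ² (cot θ/θ -
1/θ²). The partial fraction expansion of the cotangent bounds 1/θ² - cot θ/θ by `cotBound θ`
(`one_div_sq_sub_cot_le`), which increases in θ. On the hemisphere θ < β + π/2 < π by the triangle
inequality. Since c m = n-2, the m brackets together cost (n-1)(n-2) `cotBound (β + π/2)`, and this
is the constant of the theorem.

The profile h is singular at the pole s = 1, so it is multiplied by a cutoff χ(s). The errors this
creates have a favourable sign, because χ is decreasing and χ² ≤ χ (`cutoffProfile_ineq`). Fatou's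
lemma removes the cutoff for fixed φ, and a second use of it passes from test functions to the
Sobolev space; the finiteness of the potential integrals comes out of the same estimate. -/

namespace MultipolarHardy

noncomputable section

/-! ### Radial extension and gradients on the sphere -/

/-- The radial projection `x ↦ x / ‖x‖` onto the unit sphere, with a junk value at `0`. -/
def radialProj (n : ℕ) (x : Ambient n) : UnitSphere n :=
  if h : x = 0 then northPole n else ⟨‖x‖⁻¹ • x, by simp [norm_smul, h]⟩

theorem coe_radialProj {n : ℕ} {x : Ambient n} (hx : x ≠ 0) :
    (radialProj n x : Ambient n) = ‖x‖⁻¹ • x := by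
  simp [radialProj, hx]

theorem norm_sphere {n : ℕ} (y : UnitSphere n) : ‖(y : Ambient n)‖ = 1 := by simp

theorem inner_self_sphere {n : ℕ} (y : UnitSphere n) :
    inner ℝ (y : Ambient n) (y : Ambient n) = 1 := by
  simp

theorem sphere_ne_zero {n : ℕ} (y : UnitSphere n) : (y : Ambient n) ≠ 0 := by
  intro h; simpa [h] using norm_sphere y

theorem radialProj_smul {n : ℕ} (y : UnitSphere n) {r : ℝ} (hr : 0 < r) :
    radialProj n (r • (y : Ambient n)) = y := by
  apply Subtype.ext
  rw [coe_radialProj (smul_ne_zero hr.ne' (sphere_ne_zero y)), norm_smul, smul_smul]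
  simp [abs_of_pos hr, hr.ne']

@[simp]
theorem radialProj_coe {n : ℕ} (y : UnitSphere n) : radialProj n (y : Ambient n) = y := by
  simpa using radialProj_smul y one_pos

theorem contMDiffAt_radialProj {n : ℕ} {k : ℕ∞ω} {x : Ambient n} (hx : x ≠ 0) :
    ContMDiffAt 𝓘(ℝ, Ambient n) (𝓡 n) k (radialProj n) x := by
  -- Restriction of the codomain to the sphere needs norm 1 at every point of the domain, so it is
  -- carried out on the open submanifold of nonzero vectors.
  let U : TopologicalSpace.Opens (Ambient n) := ⟨{0}ᶜ, isOpen_compl_singleton⟩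
  have hU : ∀ z : U, (z : Ambient n) ≠ 0 := fun z => z.2
  have hf : ContMDiff 𝓘(ℝ, Ambient n) 𝓘(ℝ, Ambient n) k
      (fun z : U => ‖(z : Ambient n)‖⁻¹ • (z : Ambient n)) := by
    intro z
    have h1 : ContDiffAt ℝ k (fun x : Ambient n => ‖x‖⁻¹ • x) (z : Ambient n) :=
      ((contDiffAt_norm ℝ (hU z)).inv (norm_ne_zero_iff.2 (hU z))).smul contDiffAt_id
    exact h1.contMDiffAt.comp z (contMDiff_subtype_val z)
  have h2 := hf.codRestrict_sphere (n := n) (fun z => by simp [norm_smul, hU z])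
  have h3 := h2 ⟨x, hx⟩
  have h4 : (Set.codRestrict (fun z : U => ‖(z : Ambient n)‖⁻¹ • (z : Ambient n))
      (Metric.sphere 0 1) (fun z => by simp [norm_smul, hU z])) =
      fun z : U => radialProj n z := by
    funext z
    apply Subtype.ext
    rw [coe_radialProj (hU z)]
    rfl
  rw [h4] at h3
  exact contMDiffAt_subtype_iff.1 h3

theorem contDiffAt_comp_radialProj {n : ℕ} {k : ℕ∞ω} {f : UnitSphere n → ℝ}
    (hf : ContMDiff (𝓡 n) 𝓘(ℝ, ℝ) k f) {x : Ambient n} (hx : x ≠ 0) :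
    ContDiffAt ℝ k (f ∘ radialProj n) x :=
  (hf.contMDiffAt.comp x (contMDiffAt_radialProj hx)).contDiffAt

theorem inner_inclDeriv {n : ℕ} (y : UnitSphere n) (w : TangentSpace (𝓡 n) y) :
    inner ℝ (y : Ambient n) (inclDeriv n y w) = 0 := by
  have h : inclDeriv n y w ∈ (inclDeriv n y).range := ⟨w, rfl⟩
  have h1 : inclDeriv n y w ∈ (ℝ ∙ (y : Ambient n))ᗮ := by
    rw [← range_mvfderiv_subtypeVal (n := n) y]; exact h
  exact Submodule.mem_orthogonal_singleton_iff_inner_right.1 h1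

theorem exists_inclDeriv_eq {n : ℕ} (y : UnitSphere n) {v : Ambient n}
    (hv : inner ℝ (y : Ambient n) v = 0) : ∃ w, inclDeriv n y w = v := by
  have h1 : v ∈ (ℝ ∙ (y : Ambient n))ᗮ :=
    Submodule.mem_orthogonal_singleton_iff_inner_right.2 hv
  rw [← range_mvfderiv_subtypeVal (n := n) y] at h1
  exact h1

theorem inner_inclDeriv_inclDeriv {n : ℕ} (y : UnitSphere n) (v w : TangentSpace (𝓡 n) y) :
    inner ℝ (inclDeriv n y v) (inclDeriv n y w) = inner ℝ v w := rfl

theorem inner_grad_self {n : ℕ} (f : UnitSphere n → ℝ) (y : UnitSphere n) :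
    inner ℝ (y : Ambient n) (grad n f y) = 0 := inner_inclDeriv y _

theorem inner_grad_inclDeriv {n : ℕ} (f : UnitSphere n → ℝ) (y : UnitSphere n)
    (w : TangentSpace (𝓡 n) y) :
    inner ℝ (grad n f y) (inclDeriv n y w) = mvfderiv (𝓡 n) f y w := by
  rw [grad, inner_inclDeriv_inclDeriv, tangentGrad, InnerProductSpace.toDual_symm_apply]

theorem mvfderiv_of_ambient {n : ℕ} {f : UnitSphere n → ℝ} {y : UnitSphere n}
    {F : Ambient n → ℝ} {F' : Ambient n →L[ℝ] ℝ} (hF : HasFDerivAt F F' (y : Ambient n))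
    (hf : f =ᶠ[𝓝 y] fun z => F z) (w : TangentSpace (𝓡 n) y) :
    mvfderiv (𝓡 n) f y w = F' (inclDeriv n y w) := by
  have h1 : HasMFDerivAt 𝓘(ℝ, Ambient n) 𝓘(ℝ, ℝ) F (y : Ambient n) F' := hF.hasMFDerivAt
  have h2 : HasMFDerivAt (𝓡 n) 𝓘(ℝ, Ambient n) ((↑) : UnitSphere n → Ambient n) y
      (mfderiv (𝓡 n) 𝓘(ℝ, Ambient n) ((↑) : UnitSphere n → Ambient n) y) :=
    ((contMDiff_coe_sphere (m := 1) y).mdifferentiableAt one_ne_zero).hasMFDerivAt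
  have h3 := (h1.comp y h2).congr_of_eventuallyEq hf
  have h4 := h3.mfderiv
  rw [mvfderiv, h4]
  rfl

/-- The gradient of a function on the sphere from any ambient extension. -/
theorem inner_grad_of_ambient {n : ℕ} {f : UnitSphere n → ℝ} {y : UnitSphere n}
    {F : Ambient n → ℝ} {F' : Ambient n →L[ℝ] ℝ} (hF : HasFDerivAt F F' (y : Ambient n))
    (hf : f =ᶠ[𝓝 y] fun z => F z) (v : Ambient n) :
    inner ℝ (grad n f y) v =
      F' (v - inner ℝ (y : Ambient n) v • (y : Ambient n)) := by
  obtain ⟨w, hw⟩ := exists_inclDeriv_eq y (v := v - inner ℝ (y : Ambient n) v • (y : Ambient n))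
    (by rw [inner_sub_right, inner_smul_right, inner_self_sphere]; ring)
  rw [← hw, ← mvfderiv_of_ambient hF hf, ← inner_grad_inclDeriv, hw, inner_sub_right,
    inner_smul_right, real_inner_comm (y : Ambient n) (grad n f y), inner_grad_self]
  ring

theorem grad_eq_of_ambient {n : ℕ} {f : UnitSphere n → ℝ} {y : UnitSphere n}
    {F : Ambient n → ℝ} {a : Ambient n} (hF : HasFDerivAt F (innerSL ℝ a) (y : Ambient n))
    (hf : f =ᶠ[𝓝 y] fun z => F z) :
    grad n f y = a - inner ℝ (y : Ambient n) a • (y : Ambient n) := by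
  refine ext_inner_right ℝ fun v => ?_
  rw [inner_grad_of_ambient hF hf, innerSL_apply_apply, inner_sub_left, inner_sub_right,
    inner_smul_left, inner_smul_right, real_inner_comm a]
  simp
  ring

/-- The extension is constant along the ray through y. Where it is not differentiable, `fderiv` is 0
by convention. -/
theorem fderiv_comp_radialProj_self {n : ℕ} (f : UnitSphere n → ℝ) (y : UnitSphere n) :
    fderiv ℝ (f ∘ radialProj n) y y = 0 := by
  by_cases h : DifferentiableAt ℝ (f ∘ radialProj n) (y : Ambient n)
  · have h1 := h.hasFDerivAt.hasLineDerivAt (y : Ambient n)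
    have h2 : HasDerivAt (fun t : ℝ => (f ∘ radialProj n) ((y : Ambient n) + t • (y : Ambient n)))
        0 0 := by
      refine (hasDerivAt_const (0 : ℝ) (f y)).congr_of_eventuallyEq ?_
      filter_upwards [Ioi_mem_nhds (show (-1 : ℝ) < 0 by norm_num)] with t ht
      have : (y : Ambient n) + t • (y : Ambient n) = (1 + t) • (y : Ambient n) := by
        rw [add_smul, one_smul]
      rw [this, Function.comp_apply, radialProj_smul y (by linarith [Set.mem_Ioi.1 ht])]
    exact HasDerivAt.unique h1 h2
  · rw [fderiv_zero_of_not_differentiableAt h]; rfl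

/-- The degree-0 homogeneous extension has no radial derivative, so projecting v to the tangent
space changes nothing. -/
theorem inner_grad_eq_fderiv {n : ℕ} {f : UnitSphere n → ℝ}
    (hf : ContMDiff (𝓡 n) 𝓘(ℝ, ℝ) 1 f) (y : UnitSphere n) (v : Ambient n) :
    inner ℝ (grad n f y) v = fderiv ℝ (f ∘ radialProj n) y v := by
  have h1 := (contDiffAt_comp_radialProj hf (sphere_ne_zero y)).differentiableAt one_ne_zero
  rw [inner_grad_of_ambient h1.hasFDerivAt (Eventually.of_forall fun z => by simp), map_sub,
    map_smul, fderiv_comp_radialProj_self]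
  simp

theorem continuous_fderiv_comp_radialProj {n : ℕ} {f : UnitSphere n → ℝ}
    (hf : ContMDiff (𝓡 n) 𝓘(ℝ, ℝ) 1 f) :
    Continuous fun y : UnitSphere n => fderiv ℝ (f ∘ radialProj n) (y : Ambient n) := by
  refine continuous_iff_continuousAt.2 fun y => ?_
  exact ContinuousAt.comp (g := fderiv ℝ (f ∘ radialProj n)) (f := ((↑) : UnitSphere n → Ambient n))
    ((contDiffAt_comp_radialProj hf (sphere_ne_zero y)).continuousAt_fderiv one_ne_zero)
    continuous_subtype_val.continuousAt

theorem continuous_grad {n : ℕ} {f : UnitSphere n → ℝ}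
    (hf : ContMDiff (𝓡 n) 𝓘(ℝ, ℝ) 1 f) : Continuous (grad n f) := by
  have h : grad n f = fun y : UnitSphere n => (InnerProductSpace.toDual ℝ (Ambient n)).symm
      (fderiv ℝ (f ∘ radialProj n) (y : Ambient n)) := by
    funext y
    refine ext_inner_right ℝ fun v => ?_
    rw [inner_grad_eq_fderiv hf, InnerProductSpace.toDual_symm_apply]
  rw [h]
  exact (LinearIsometryEquiv.continuous _).comp (continuous_fderiv_comp_radialProj hf)

/-! ### Geodesic distance as an arccosine, and its gradient -/

theorem hasDerivWithinAt_coe_comp {n : ℕ} {γ : ℝ → UnitSphere n} {s : Set ℝ} {t : ℝ}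
    (h : MDifferentiableWithinAt 𝓘(ℝ, ℝ) (𝓡 n) γ s t) :
    HasDerivWithinAt (fun t => (γ t : Ambient n))
      (inclDeriv n (γ t) (mfderivWithin 𝓘(ℝ, ℝ) (𝓡 n) γ s t (1 : ℝ))) s t := by
  have h2 : HasMFDerivAt (𝓡 n) 𝓘(ℝ, Ambient n) ((↑) : UnitSphere n → Ambient n) (γ t)
      (mfderiv (𝓡 n) 𝓘(ℝ, Ambient n) ((↑) : UnitSphere n → Ambient n) (γ t)) :=
    ((contMDiff_coe_sphere (m := 1) (γ t)).mdifferentiableAt one_ne_zero).hasMFDerivAt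
  have h3 := h2.comp_hasMFDerivWithinAt t h.hasMFDerivWithinAt
  have h4 := hasMFDerivWithinAt_iff_hasFDerivWithinAt.1 h3
  have h5 := HasFDerivWithinAt.hasDerivWithinAt (F := Ambient n) (f := fun t => (γ t : Ambient n)) h4
  exact h5

theorem abs_inner_sphere_le_one {n : ℕ} (x y : UnitSphere n) :
    |inner ℝ (x : Ambient n) (y : Ambient n)| ≤ 1 := by
  simpa using abs_real_inner_le_norm (x : Ambient n) (y : Ambient n)

theorem inner_le_one_sphere {n : ℕ} (x y : UnitSphere n) :
    inner ℝ (x : Ambient n) (y : Ambient n) ≤ 1 :=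
  (abs_le.1 (abs_inner_sphere_le_one x y)).2

theorem neg_one_le_inner_sphere {n : ℕ} (x y : UnitSphere n) :
    -1 ≤ inner ℝ (x : Ambient n) (y : Ambient n) :=
  (abs_le.1 (abs_inner_sphere_le_one x y)).1

theorem norm_sub_inner_smul_sq {n : ℕ} (y p : UnitSphere n) :
    ‖(p : Ambient n) - inner ℝ (y : Ambient n) (p : Ambient n) • (y : Ambient n)‖ ^ 2 =
      1 - inner ℝ (y : Ambient n) (p : Ambient n) ^ 2 := by
  rw [norm_sub_sq_real, inner_smul_right, norm_smul, real_inner_comm (y : Ambient n), norm_sphere,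
    norm_sphere, Real.norm_eq_abs, mul_one, sq_abs]
  ring

/-- For `c < 1` the function `x ↦ arccos (c ⟨x, p⟩)` is `1`-Lipschitz along tangent directions. -/
theorem norm_inner_div_sqrt_le {n : ℕ} {c : ℝ} (hc : 0 ≤ c) (hc1 : c < 1)
    (y p : UnitSphere n) {v : Ambient n} (hv : inner ℝ (y : Ambient n) v = 0) :
    ‖-(1 / √(1 - (c * inner ℝ (y : Ambient n) (p : Ambient n)) ^ 2)) *
      (c * inner ℝ v (p : Ambient n))‖ ≤ ‖v‖ := by
  set s : ℝ := inner ℝ (y : Ambient n) (p : Ambient n) with hs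
  have hs1 := abs_inner_sphere_le_one y p
  rw [← hs] at hs1
  have hs2 : s ^ 2 ≤ 1 := (sq_le_one_iff_abs_le_one s).2 hs1
  have hc2 : c ^ 2 < 1 := by nlinarith
  have hpos : 0 < 1 - (c * s) ^ 2 := by nlinarith [sq_nonneg s, sq_nonneg c]
  -- Only the tangential part of p, of length √(1 - s²), pairs with v. The factor c √(1 - s²) is at
  -- most √(1 - c²s²) because c ≤ 1.
  have h1 : inner ℝ v (p : Ambient n) = inner ℝ v ((p : Ambient n) - s • (y : Ambient n)) := by
    rw [inner_sub_right, inner_smul_right, real_inner_comm (y : Ambient n) v, hv]; ring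
  have h2 : |inner ℝ v (p : Ambient n)| ≤ ‖v‖ * √(1 - s ^ 2) := by
    rw [h1, ← norm_sub_inner_smul_sq y p, ← hs, Real.sqrt_sq (norm_nonneg _)]
    exact abs_real_inner_le_norm _ _
  have h3 : c * √(1 - s ^ 2) ≤ √(1 - (c * s) ^ 2) := by
    apply Real.le_sqrt_of_sq_le
    rw [mul_pow, Real.sq_sqrt (by linarith)]
    nlinarith
  have hr : 0 < √(1 - (c * s) ^ 2) := Real.sqrt_pos.2 hpos
  rw [Real.norm_eq_abs, abs_mul, abs_neg, abs_mul, abs_of_nonneg hc,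
    abs_of_pos (one_div_pos.2 hr), one_div, inv_mul_le_iff₀ hr]
  calc c * |inner ℝ v (p : Ambient n)| ≤ c * (‖v‖ * √(1 - s ^ 2)) := by gcongr
    _ = (c * √(1 - s ^ 2)) * ‖v‖ := by ring
    _ ≤ _ := by gcongr

/-- The factor c < 1 keeps the argument of `arccos` inside (-1, 1), where it is smooth, even if the
path meets p or its antipode. The fundamental theorem of calculus and the Lipschitz bound then give
the estimate; c tends to 1 afterwards. -/
theorem arccos_mul_sub_le_pathELength {n : ℕ} {c : ℝ} (hc : 0 ≤ c) (hc1 : c < 1)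
    (p : UnitSphere n) {γ : ℝ → UnitSphere n}
    (hγ : ContMDiffOn 𝓘(ℝ, ℝ) (𝓡 n) 1 γ (Set.Icc 0 1)) :
    ENNReal.ofReal (Real.arccos (c * inner ℝ (γ 0 : Ambient n) (p : Ambient n)) -
      Real.arccos (c * inner ℝ (γ 1 : Ambient n) (p : Ambient n))) ≤
      Manifold.pathELength (𝓡 n) γ 0 1 := by
  have hlt : ∀ y : UnitSphere n, |c * inner ℝ (y : Ambient n) (p : Ambient n)| < 1 := fun y => by
    rw [abs_mul, abs_of_nonneg hc]
    nlinarith [abs_inner_sphere_le_one y p,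
      abs_nonneg (inner ℝ (y : Ambient n) (p : Ambient n) : ℝ)]
  set e : ℝ → Ambient n := fun t => (γ t : Ambient n) with he
  have heC : ContDiffOn ℝ 1 e (Set.Icc 0 1) :=
    contMDiffOn_iff_contDiffOn.1 ((contMDiff_coe_sphere (m := 1)).comp_contMDiffOn hγ)
  have hgC : ContDiffOn ℝ 1 (fun t => Real.arccos (c * inner ℝ (e t) (p : Ambient n)))
      (Set.Icc 0 1) := by
    intro t ht
    have h1 : ContDiffWithinAt ℝ 1 (fun t => c * inner ℝ (e t) (p : Ambient n)) (Set.Icc 0 1) t :=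
      contDiffWithinAt_const.mul ((heC t ht).inner ℝ contDiffWithinAt_const)
    have h2 := abs_lt.1 (hlt (γ t))
    exact ContDiffAt.comp_contDiffWithinAt (g := Real.arccos) t
      (Real.contDiffAt_arccos h2.1.ne' h2.2.ne) h1
  have hmain := enorm_sub_le_lintegral_derivWithin_Icc_of_contDiffOn_Icc hgC zero_le_one
  rw [Manifold.pathELength_eq_lintegral_mfderivWithin_Icc]
  refine le_trans ?_ (hmain.trans ?_)
  · rw [enorm_sub_rev, Real.enorm_eq_ofReal_abs]
    exact ENNReal.ofReal_le_ofReal (le_abs_self _)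
  · refine setLIntegral_mono' measurableSet_Icc fun t ht => ?_
    have h1 := hasDerivWithinAt_coe_comp ((hγ t ht).mdifferentiableWithinAt one_ne_zero)
    have h2 := (h1.inner ℝ (hasDerivWithinAt_const t _ (p : Ambient n))).const_mul c
    have hl := abs_lt.1 (hlt (γ t))
    have h3 := (Real.hasDerivAt_arccos hl.1.ne' hl.2.ne).comp_hasDerivWithinAt t h2
    have h4 := h3.derivWithin (uniqueDiffOn_Icc zero_lt_one t ht)
    have h5 : derivWithin (fun t => Real.arccos (c * inner ℝ (e t) (p : Ambient n)))
      (Set.Icc 0 1) t = _ := h4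
    rw [h5, enorm_le_iff_norm_le, ← norm_inclDeriv]
    · have := norm_inner_div_sqrt_le hc hc1 (γ t) p (inner_inclDeriv (γ t)
        (mfderivWithin 𝓘(ℝ, ℝ) (𝓡 n) γ (Set.Icc 0 1) t (1 : ℝ)))
      rw [inner_zero_right, zero_add]
      exact this

theorem arccos_inner_le_riemannianEDist {n : ℕ} (y p : UnitSphere n) :
    ENNReal.ofReal (Real.arccos (inner ℝ (y : Ambient n) (p : Ambient n))) ≤
      Manifold.riemannianEDist (𝓡 n) y p := by
  refine le_of_forall_gt fun r hr => ?_
  obtain ⟨γ, h0, h1, hγ, hlen⟩ := Manifold.exists_lt_of_riemannianEDist_lt hr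
  refine lt_of_le_of_lt ?_ hlen
  have hT : Tendsto (fun c : ℝ => ENNReal.ofReal
      (Real.arccos (c * inner ℝ (y : Ambient n) (p : Ambient n)) -
        Real.arccos (c * inner ℝ (p : Ambient n) (p : Ambient n)))) (𝓝[<] 1)
      (𝓝 (ENNReal.ofReal (Real.arccos (inner ℝ (y : Ambient n) (p : Ambient n))))) := by
    have hcont : Continuous (fun c : ℝ => ENNReal.ofReal
      (Real.arccos (c * inner ℝ (y : Ambient n) (p : Ambient n)) -
        Real.arccos (c * inner ℝ (p : Ambient n) (p : Ambient n)))) :=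
      ENNReal.continuous_ofReal.comp
        ((Real.continuous_arccos.comp (continuous_id.mul continuous_const)).sub
          (Real.continuous_arccos.comp (continuous_id.mul continuous_const)))
    have h := (hcont.tendsto 1).mono_left (nhdsWithin_le_nhds (s := Set.Iio 1))
    simpa [inner_self_sphere] using h
  refine le_of_tendsto hT ?_
  filter_upwards [Ioo_mem_nhdsLT (show (0 : ℝ) < 1 by norm_num)] with c hc
  have := arccos_mul_sub_le_pathELength hc.1.le hc.2 p hγ
  rwa [h0, h1] at this

/-- The unit speed great circle arc from y, with initial direction w along the tangential part of p,
reaches p at time arccos s. The antipode is excluded because there the tangential part vanishes and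
gives no direction. -/
theorem riemannianEDist_le_arccos_inner {n : ℕ} {y p : UnitSphere n}
    (h : -1 < inner ℝ (y : Ambient n) (p : Ambient n)) :
    Manifold.riemannianEDist (𝓡 n) y p ≤
      ENNReal.ofReal (Real.arccos (inner ℝ (y : Ambient n) (p : Ambient n))) := by
  rcases eq_or_ne y p with rfl | hne
  · rw [Manifold.riemannianEDist_self]
    exact zero_le
  set s : ℝ := inner ℝ (y : Ambient n) (p : Ambient n) with hs
  have hs1 : s < 1 := lt_of_le_of_ne (inner_le_one_sphere y p) fun h1 =>
    hne (Subtype.ext ((inner_eq_one_iff_of_norm_eq_one (norm_sphere y) (norm_sphere p)).1 h1))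
  have hr : 0 < √(1 - s ^ 2) := Real.sqrt_pos.2 (by nlinarith)
  set w : Ambient n := (√(1 - s ^ 2))⁻¹ • ((p : Ambient n) - s • (y : Ambient n)) with hw
  have hw1 : ‖w‖ = 1 := by
    rw [hw, norm_smul, norm_inv, Real.norm_of_nonneg hr.le, ← norm_sub_inner_smul_sq y p,
      ← hs, Real.sqrt_sq (norm_nonneg _)]
    apply inv_mul_cancel₀
    intro h0
    have := norm_sub_inner_smul_sq y p
    rw [← hs, h0] at this
    nlinarith
  have hyw : inner ℝ (y : Ambient n) w = 0 := by
    rw [hw, inner_smul_right, inner_sub_right, inner_smul_right, inner_self_sphere, ← hs]; ring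
  have hnorm : ∀ a b : ℝ, a ^ 2 + b ^ 2 = 1 → ‖a • (y : Ambient n) + b • w‖ = 1 := by
    intro a b hab
    have h2 : ‖a • (y : Ambient n) + b • w‖ ^ 2 = 1 := by
      rw [norm_add_sq_real, inner_smul_left, inner_smul_right, hyw, norm_smul, norm_smul, hw1,
        norm_sphere, Real.norm_eq_abs, Real.norm_eq_abs, mul_one, mul_one, sq_abs, sq_abs]
      linarith [hab]
    nlinarith [norm_nonneg (a • (y : Ambient n) + b • w)]
  let g : ℝ → Ambient n := fun t => Real.cos t • (y : Ambient n) + Real.sin t • w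
  have hg : ∀ t, g t ∈ Metric.sphere (0 : Ambient n) 1 := fun t => by
    simpa using hnorm _ _ (Real.cos_sq_add_sin_sq t)
  have hgC : ContDiff ℝ 1 g := by
    exact (Real.contDiff_cos.smul contDiff_const).add (Real.contDiff_sin.smul contDiff_const)
  have hγ : ContMDiff 𝓘(ℝ, ℝ) (𝓡 n) 1 (Set.codRestrict g _ hg) :=
    hgC.contMDiff.codRestrict_sphere (n := n) hg
  set γ : ℝ → UnitSphere n := Set.codRestrict g _ hg with hγdef
  have h0 : γ 0 = y := Subtype.ext (by simp [hγdef, g])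
  have h1 : γ (Real.arccos s) = p := by
    apply Subtype.ext
    simp only [hγdef, g, Set.val_codRestrict_apply, Real.cos_arccos h.le hs1.le, Real.sin_arccos]
    rw [hw, smul_inv_smul₀ hr.ne']
    simp
  refine (Manifold.riemannianEDist_le_pathELength hγ.contMDiffOn h0 h1
    (Real.arccos_nonneg s)).trans ?_
  rw [Manifold.pathELength_eq_lintegral_mfderiv_Icc]
  have h2 : ∀ t, ‖mfderiv 𝓘(ℝ, ℝ) (𝓡 n) γ t (1 : ℝ)‖ₑ = 1 := fun t => by
    have h3 := hasDerivWithinAt_coe_comp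
      ((hγ t).mdifferentiableAt one_ne_zero).mdifferentiableWithinAt (s := Set.univ)
    rw [mfderivWithin_univ, hasDerivWithinAt_univ] at h3
    have h4 : HasDerivAt g (-Real.sin t • (y : Ambient n) + Real.cos t • w) t :=
      ((Real.hasDerivAt_cos t).smul_const _).add ((Real.hasDerivAt_sin t).smul_const _)
    have h5 := h3.unique h4
    rw [← ofReal_norm, ← norm_inclDeriv, h5, hnorm _ _ (by
      rw [neg_sq]; exact Real.sin_sq_add_cos_sq t)]
    simp
  calc _ = ∫⁻ _ in Set.Icc 0 (Real.arccos s), (1 : ENNReal) := lintegral_congr h2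
    _ ≤ _ := by simp

theorem geodDist_eq_arccos {n : ℕ} {y p : UnitSphere n}
    (h : -1 < inner ℝ (y : Ambient n) (p : Ambient n)) :
    geodDist n y p = Real.arccos (inner ℝ (y : Ambient n) (p : Ambient n)) := by
  rw [geodDist, le_antisymm (riemannianEDist_le_arccos_inner h)
    (arccos_inner_le_riemannianEDist y p), ENNReal.toReal_ofReal (Real.arccos_nonneg _)]

theorem hasFDerivAt_arccos_inner {n : ℕ} {y p : UnitSphere n}
    (h : -1 < inner ℝ (y : Ambient n) (p : Ambient n))
    (h1 : inner ℝ (y : Ambient n) (p : Ambient n) < 1) :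
    HasFDerivAt (fun x : Ambient n => Real.arccos (inner ℝ x (p : Ambient n)))
      (innerSL ℝ (-(√(1 - inner ℝ (y : Ambient n) (p : Ambient n) ^ 2))⁻¹ • (p : Ambient n)))
      (y : Ambient n) := by
  have h2 : HasFDerivAt (fun x : Ambient n => (inner ℝ x (p : Ambient n) : ℝ))
      (innerSL ℝ (p : Ambient n)) (y : Ambient n) := by
    have := (innerSL ℝ (p : Ambient n)).hasFDerivAt (x := (y : Ambient n))
    refine this.congr_of_eventuallyEq (Eventually.of_forall fun x => ?_)
    simp [real_inner_comm]
  have h3 := (Real.hasDerivAt_arccos h.ne' h1.ne).comp_hasFDerivAt (y : Ambient n) h2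
  convert! h3 using 1
  rw [map_smul, one_div]

/-- The gradient of the distance to `p` away from `p` and its antipode. -/
theorem grad_geodDist {n : ℕ} {y p : UnitSphere n}
    (h : -1 < inner ℝ (y : Ambient n) (p : Ambient n))
    (h1 : inner ℝ (y : Ambient n) (p : Ambient n) < 1) :
    grad n (fun z => geodDist n z p) y =
      -(√(1 - inner ℝ (y : Ambient n) (p : Ambient n) ^ 2))⁻¹ •
        ((p : Ambient n) - inner ℝ (y : Ambient n) (p : Ambient n) • (y : Ambient n)) := by
  rw [grad_eq_of_ambient (hasFDerivAt_arccos_inner h h1), inner_smul_right, smul_sub, smul_smul]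
  have hc : Continuous fun z : UnitSphere n => (inner ℝ (z : Ambient n) (p : Ambient n) : ℝ) :=
    continuous_subtype_val.inner continuous_const
  filter_upwards [hc.continuousAt.eventually (Ioi_mem_nhds h)] with z hz
  exact geodDist_eq_arccos hz

theorem inner_northPole {n : ℕ} (y : UnitSphere n) :
    inner ℝ (northPole n : Ambient n) (y : Ambient n) = (y : Ambient n) (Fin.last n) := by
  simp [northPole, EuclideanSpace.inner_single_left]

theorem arccos_inner_eq_angle {n : ℕ} (y p : UnitSphere n) :
    Real.arccos (inner ℝ (y : Ambient n) (p : Ambient n)) =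
      InnerProductGeometry.angle (y : Ambient n) (p : Ambient n) := by
  simp [InnerProductGeometry.angle]

theorem arccos_inner_northPole_lt {n : ℕ} {y : UnitSphere n} (hy : y ∈ upperHemisphere n) :
    Real.arccos (inner ℝ (northPole n : Ambient n) (y : Ambient n)) < Real.pi / 2 := by
  rw [Real.arccos_lt_pi_div_two, inner_northPole]
  exact hy

theorem geodDist_northPole_eq {n : ℕ} {y : UnitSphere n} (hy : y ∈ upperHemisphere n) :
    geodDist n (northPole n) y =
      Real.arccos (inner ℝ (northPole n : Ambient n) (y : Ambient n)) := by
  refine geodDist_eq_arccos ?_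
  rw [inner_northPole]
  exact lt_trans (by norm_num) hy

/-- Triangle inequality for angles, through the north pole. This is where β + π/2 comes from. -/
theorem arccos_inner_lt_of_mem_upperHemisphere {n : ℕ} {y p : UnitSphere n}
    (hy : y ∈ upperHemisphere n) :
    Real.arccos (inner ℝ (y : Ambient n) (p : Ambient n)) <
      Real.arccos (inner ℝ (northPole n : Ambient n) (p : Ambient n)) + Real.pi / 2 := by
  have h1 := arccos_inner_northPole_lt hy
  rw [arccos_inner_eq_angle] at h1 ⊢
  rw [arccos_inner_eq_angle]
  have h2 := InnerProductGeometry.angle_le_angle_add_angle (y : Ambient n) (northPole n)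
    (p : Ambient n)
  rw [InnerProductGeometry.angle_comm (y : Ambient n) (northPole n)] at h2
  linarith

theorem neg_one_lt_inner_of_mem_upperHemisphere {n : ℕ} {y p : UnitSphere n}
    (hy : y ∈ upperHemisphere n) (hp : p ∈ upperHemisphere n) :
    -1 < inner ℝ (y : Ambient n) (p : Ambient n) := by
  refine lt_of_le_of_ne (neg_one_le_inner_sphere y p) fun h => ?_
  have h1 := arccos_inner_lt_of_mem_upperHemisphere (p := p) hy
  have h2 := arccos_inner_northPole_lt hp
  rw [← h, Real.arccos_neg_one] at h1
  linarith

/-! ### Polar coordinates and the divergence theorem on the sphere -/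

/-- Integration in polar coordinates of a function that separates into an angular and a radial
factor. -/
theorem integral_of_separated {n : ℕ} {G : Ambient n → ℝ} {a : UnitSphere n → ℝ} {b : ℝ → ℝ}
    (hG : ∀ (y : UnitSphere n) (r : ℝ), 0 < r → G (r • (y : Ambient n)) = a y * b r) :
    ∫ x, G x = (∫ y, a y ∂(sphereVolume n)) * ∫ r in Set.Ioi (0 : ℝ), r ^ n * b r := by
  have hd : Module.finrank ℝ (Ambient n) - 1 = n := by simp
  calc ∫ x, G x = ∫ x : ({(0 : Ambient n)}ᶜ : Set (Ambient n)), G x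
          ∂((volume : Measure (Ambient n)).comap (↑)) := by
        rw [integral_subtype_comap (measurableSet_singleton _).compl G, restrict_compl_singleton]
    _ = ∫ z : UnitSphere n × Set.Ioi (0 : ℝ), a z.1 * b z.2
          ∂(volume : Measure (Ambient n)).toSphere.prod (Measure.volumeIoiPow n) := by
        have h := (volume : Measure (Ambient n)).measurePreserving_homeomorphUnitSphereProd
        rw [hd] at h
        rw [← h.integral_comp (Homeomorph.measurableEmbedding _)]
        refine integral_congr_ae (Eventually.of_forall fun x => ?_)
        have hx : 0 < ‖(x : Ambient n)‖ := norm_pos_iff.2 x.2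
        refine Eq.trans ?_ (hG _ _ (homeomorphUnitSphereProd (Ambient n) x).2.2)
        simp [smul_smul, hx.ne']
    _ = (∫ y, a y ∂(sphereVolume n)) * ∫ r : Set.Ioi (0 : ℝ), b r ∂(Measure.volumeIoiPow n) :=
        integral_prod_mul a (fun r : Set.Ioi (0 : ℝ) => b r)
    _ = _ := by
        congr 1
        simp only [Measure.volumeIoiPow, ENNReal.ofReal]
        rw [integral_withDensity_eq_integral_smul
            ((measurable_subtype_coe.pow_const _).real_toNNReal),
          integral_subtype_comap measurableSet_Ioi fun r : ℝ => Real.toNNReal (r ^ n) • b r,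
          setIntegral_congr_fun measurableSet_Ioi fun r hr => ?_]
        rw [NNReal.smul_def, Real.coe_toNNReal _ (pow_nonneg (Set.mem_Ioi.1 hr).le _), smul_eq_mul]

theorem radialProj_smul_eq {n : ℕ} {r : ℝ} (hr : 0 < r) (x : Ambient n) :
    radialProj n (r • x) = radialProj n x := by
  by_cases hx : x = 0
  · simp [hx]
  · apply Subtype.ext
    rw [coe_radialProj (smul_ne_zero hr.ne' hx), coe_radialProj hx, norm_smul, smul_smul,
      Real.norm_of_nonneg hr.le]
    congr 1
    field_simp

/-- The derivative of a function homogeneous of degree 0 is homogeneous of degree -1. -/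
theorem fderiv_comp_radialProj_smul {n : ℕ} {f : UnitSphere n → ℝ}
    (hf : ContMDiff (𝓡 n) 𝓘(ℝ, ℝ) 1 f) (y : UnitSphere n) {r : ℝ} (hr : 0 < r) (v : Ambient n) :
    fderiv ℝ (f ∘ radialProj n) (r • (y : Ambient n)) v =
      fderiv ℝ (f ∘ radialProj n) (y : Ambient n) v * r⁻¹ := by
  have h1 := ((contDiffAt_comp_radialProj hf (sphere_ne_zero y)).differentiableAt
    one_ne_zero).hasFDerivAt
  have h2 : HasFDerivAt (fun x : Ambient n => r⁻¹ • x)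
      (r⁻¹ • ContinuousLinearMap.id ℝ (Ambient n)) (r • (y : Ambient n)) :=
    (hasFDerivAt_id _).const_smul r⁻¹
  have h3 : (y : Ambient n) = r⁻¹ • r • (y : Ambient n) := by rw [inv_smul_smul₀ hr.ne']
  have h1' : HasFDerivAt (f ∘ radialProj n) (fderiv ℝ (f ∘ radialProj n) (y : Ambient n))
      (r⁻¹ • r • (y : Ambient n)) := by rw [← h3]; exact h1
  have h4 := h1'.comp (r • (y : Ambient n)) h2
  have h5 : (f ∘ radialProj n) ∘ (fun x : Ambient n => r⁻¹ • x) = f ∘ radialProj n := by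
    funext x
    simp [radialProj_smul_eq (inv_pos.2 hr)]
  rw [h5] at h4
  rw [h4.fderiv]
  simp [mul_comm]

/-- A bump function on `ℝ` around `1`, supported away from `0`. -/
def radialBump : ContDiffBump (1 : ℝ) := ⟨1 / 4, 1 / 2, by norm_num, by norm_num⟩

theorem mem_of_mem_tsupport_radialBump {t : ℝ} (h : t ∈ tsupport radialBump) :
    1 / 2 ≤ t ∧ t ≤ 3 / 2 := by
  rw [ContDiffBump.tsupport_eq, Metric.mem_closedBall, Real.dist_eq] at h
  have := abs_le.1 h
  simp only [radialBump] at this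
  constructor <;> linarith

theorem contDiff_radialBump_sq : ContDiff ℝ 1 fun r : ℝ => radialBump (r ^ 2) :=
  radialBump.contDiff.comp (contDiff_id.pow 2)

theorem hasCompactSupport_of_radialBump {g : ℝ → ℝ}
    (hg : ∀ r, r ^ 2 ∉ tsupport radialBump → g r = 0) : HasCompactSupport g := by
  refine HasCompactSupport.intro (isCompact_Icc (a := (-2 : ℝ)) (b := 2)) fun r hr => hg r ?_
  intro h
  have := mem_of_mem_tsupport_radialBump h
  exact hr ⟨by nlinarith, by nlinarith⟩

theorem integral_radialBump_pos (n : ℕ) :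
    0 < ∫ r in Set.Ioi (0 : ℝ), r ^ n * radialBump (r ^ 2) := by
  have hc : Continuous fun r : ℝ => r ^ n * radialBump (r ^ 2) :=
    (continuous_pow n).mul contDiff_radialBump_sq.continuous
  have hs : HasCompactSupport fun r : ℝ => r ^ n * radialBump (r ^ 2) :=
    hasCompactSupport_of_radialBump fun r hr => by rw [image_eq_zero_of_notMem_tsupport hr, mul_zero]
  rw [setIntegral_pos_iff_support_of_nonneg_ae]
  · refine lt_of_lt_of_le ?_ (measure_mono (show Set.Ioo (1 : ℝ) (11 / 10) ⊆ _ from ?_))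
    · simp; norm_num
    · intro r hr
      refine ⟨?_, Set.mem_Ioi.2 (by linarith [hr.1])⟩
      have h1 : radialBump (r ^ 2) = 1 := by
        apply radialBump.one_of_mem_closedBall
        rw [Metric.mem_closedBall, Real.dist_eq, abs_le]
        simp only [radialBump]
        constructor <;> nlinarith [hr.1, hr.2]
      rw [Function.mem_support, h1, mul_one]
      exact pow_ne_zero _ (by linarith [hr.1])
  · refine (ae_restrict_mem measurableSet_Ioi).mono fun r hr => ?_
    exact mul_nonneg (pow_nonneg (Set.mem_Ioi.1 hr).le _) radialBump.nonneg
  · exact (hc.integrable_of_hasCompactSupport hs).integrableOn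

/-- The derivative of r^(n+1) χ(r²) has integral 0 over (0, ∞): the function has compact support and
vanishes at r = 0. This supplies the dimensional factor in the divergence theorem. -/
theorem integral_radialBump_deriv (n : ℕ) :
    ∫ r in Set.Ioi (0 : ℝ), r ^ (n + 1) * (2 * r * deriv radialBump (r ^ 2)) =
      -((n + 1 : ℕ) : ℝ) * ∫ r in Set.Ioi (0 : ℝ), r ^ n * radialBump (r ^ 2) := by
  have hC : ContDiff ℝ 1 fun r : ℝ => r ^ (n + 1) * radialBump (r ^ 2) :=
    (contDiff_id.pow (n + 1)).mul contDiff_radialBump_sq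
  have hs : HasCompactSupport fun r : ℝ => r ^ (n + 1) * radialBump (r ^ 2) :=
    hasCompactSupport_of_radialBump fun r hr => by rw [image_eq_zero_of_notMem_tsupport hr, mul_zero]
  have h1 := hs.integral_Ioi_deriv_eq hC 0
  have hd : ∀ r : ℝ, deriv (fun r : ℝ => r ^ (n + 1) * radialBump (r ^ 2)) r =
      ((n + 1 : ℕ) : ℝ) * (r ^ n * radialBump (r ^ 2)) +
        r ^ (n + 1) * (2 * r * deriv radialBump (r ^ 2)) := fun r => by
    have h2 : HasDerivAt radialBump (deriv radialBump (r ^ 2)) (r ^ 2) :=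
      (radialBump.contDiff (n := 1)).differentiable one_ne_zero _ |>.hasDerivAt
    have h3 : HasDerivAt (fun r : ℝ => radialBump (r ^ 2)) _ r :=
      HasDerivAt.comp (h := fun r : ℝ => r ^ 2) (h₂ := radialBump) r h2 (hasDerivAt_pow 2 r)
    refine ((hasDerivAt_pow (n + 1) r).mul h3).deriv.trans ?_
    simp
    ring
  have hi1 : Integrable fun r : ℝ => r ^ n * radialBump (r ^ 2) :=
    Continuous.integrable_of_hasCompactSupport
      ((continuous_pow n).mul contDiff_radialBump_sq.continuous)
      (hasCompactSupport_of_radialBump fun r hr => by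
        exact mul_eq_zero_of_right _ (image_eq_zero_of_notMem_tsupport hr))
  have hi2 : Integrable fun r : ℝ => r ^ (n + 1) * (2 * r * deriv radialBump (r ^ 2)) := by
    have hdc : Continuous (deriv radialBump) :=
      (radialBump.contDiff (n := 1)).continuous_deriv le_rfl
    refine Continuous.integrable_of_hasCompactSupport (by fun_prop)
      (hasCompactSupport_of_radialBump fun r hr => ?_)
    have : deriv radialBump (r ^ 2) = 0 :=
      image_eq_zero_of_notMem_tsupport fun h => hr (tsupport_deriv_subset h)
    rw [this]; ring
  simp only [hd] at h1
  rw [integral_add (hi1.const_mul _).integrableOn hi2.integrableOn, integral_const_mul] at h1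
  simp at h1
  push_cast
  linarith

theorem hasFDerivAt_radialBump_norm_sq {n : ℕ} (x : Ambient n) :
    HasFDerivAt (fun x : Ambient n => radialBump (‖x‖ ^ 2))
      (deriv radialBump (‖x‖ ^ 2) • (2 • innerSL ℝ x)) x := by
  have h2 : HasDerivAt radialBump (deriv radialBump (‖x‖ ^ 2)) (‖x‖ ^ 2) :=
    (radialBump.contDiff (n := 1)).differentiable one_ne_zero _ |>.hasDerivAt
  exact HasDerivAt.comp_hasFDerivAt (h₂ := radialBump) x h2 (hasStrictFDerivAt_norm_sq x).hasFDerivAt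

/-- The bump confines the product to an annulus, where b is continuous; a singularity of b at the
origin is harmless. -/
theorem integrable_mul_of_radialBump {n : ℕ} {g : ℝ → ℝ} (hgc : Continuous g)
    (hg : tsupport g ⊆ tsupport radialBump) {b : Ambient n → ℝ}
    (hb : ∀ x, x ≠ 0 → ContinuousAt b x) : Integrable fun x : Ambient n => g (‖x‖ ^ 2) * b x := by
  have hsub : ∀ x : Ambient n, ‖x‖ ^ 2 ∉ tsupport g → g (‖x‖ ^ 2) * b x = 0 := fun x hx => by
    rw [image_eq_zero_of_notMem_tsupport hx, zero_mul]
  have hts : tsupport (fun x : Ambient n => g (‖x‖ ^ 2) * b x) ⊆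
      {x | ‖x‖ ^ 2 ∈ tsupport g} := by
    refine closure_minimal (fun x hx => ?_)
      ((isClosed_tsupport g).preimage (continuous_norm.pow 2))
    by_contra h
    exact hx (hsub x h)
  refine Continuous.integrable_of_hasCompactSupport (continuous_of_tsupport fun x hx => ?_)
    (HasCompactSupport.intro (isCompact_closedBall (0 : Ambient n) 2) fun x hx => hsub x ?_)
  · have h := mem_of_mem_tsupport_radialBump (hg (hts hx))
    have hx0 : x ≠ 0 := by rintro rfl; norm_num at h
    exact (hgc.comp (continuous_norm.pow 2)).continuousAt.mul (hb x hx0)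
  · intro h
    have h := mem_of_mem_tsupport_radialBump (hg h)
    apply hx
    rw [mem_closedBall_zero_iff]
    nlinarith [norm_nonneg x]

/-- The divergence theorem on the sphere for the gradient of a linear function. -/
theorem integral_inner_grad {n : ℕ} {f : UnitSphere n → ℝ}
    (hf : ContMDiff (𝓡 n) 𝓘(ℝ, ℝ) 1 f) (hn : 1 ≤ n) (p : Ambient n) :
    ∫ y, inner ℝ (grad n f y) p ∂(sphereVolume n) =
      n * ∫ y, inner ℝ (y : Ambient n) p * f y ∂(sphereVolume n) := by
  obtain ⟨k, rfl⟩ : ∃ k, n = k + 1 := ⟨n - 1, by omega⟩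
  set F := f ∘ radialProj (k + 1) with hF
  have hFC : ∀ x, x ≠ 0 → ContDiffAt ℝ 1 F x := fun x hx => contDiffAt_comp_radialProj hf hx
  have hbc : Continuous (radialBump : ℝ → ℝ) := radialBump.continuous
  have hdc : Continuous (deriv radialBump) :=
    (radialBump.contDiff (n := 1)).continuous_deriv le_rfl
  have hfd : ∀ x : Ambient (k + 1), fderiv ℝ (fun x : Ambient (k + 1) => radialBump (‖x‖ ^ 2)) x p =
      deriv radialBump (‖x‖ ^ 2) * (2 * inner ℝ x p) := fun x => by
    rw [(hasFDerivAt_radialBump_norm_sq x).fderiv]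
    simp
  -- Integration by parts in ℝⁿ⁺¹ of a radial bump against the homogeneous extension F. Both sides
  -- split in polar coordinates, and the common radial integral is cancelled at the end.
  have hparts := integral_mul_fderiv_eq_neg_fderiv_mul_of_integrable (μ := volume)
    (f := fun x : Ambient (k + 1) => radialBump (‖x‖ ^ 2)) (g := F) (v := p)
    (by
      simp only [hfd, mul_assoc]
      exact integrable_mul_of_radialBump hdc tsupport_deriv_subset fun x hx =>
        continuousAt_const.mul
          ((continuous_id.inner continuous_const).continuousAt.mul (hFC x hx).continuousAt))
    (integrable_mul_of_radialBump hbc subset_rfl fun x hx =>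
      ((hFC x hx).continuousAt_fderiv one_ne_zero).clm_apply continuousAt_const)
    (integrable_mul_of_radialBump hbc subset_rfl fun x hx => (hFC x hx).continuousAt)
    (fun x _ => (hasFDerivAt_radialBump_norm_sq x).differentiableAt)
    (fun x hx => by
      refine (hFC x ?_).differentiableAt one_ne_zero
      rintro rfl
      have h1 : (0 : Ambient (k + 1)) ∈
          (fun x : Ambient (k + 1) => ‖x‖ ^ 2) ⁻¹' tsupport radialBump :=
        tsupport_comp_subset_preimage _ (continuous_norm.pow 2) hx
      have h2 := mem_of_mem_tsupport_radialBump h1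
      norm_num at h2)
  have hnorm : ∀ (y : UnitSphere (k + 1)) (r : ℝ), ‖r • (y : Ambient (k + 1))‖ ^ 2 = r ^ 2 :=
    fun y r => by rw [norm_smul, norm_sphere, mul_one, Real.norm_eq_abs, sq_abs]
  rw [integral_of_separated (n := k + 1) (a := fun y => inner ℝ (grad (k + 1) f y) p)
      (b := fun r => r⁻¹ * radialBump (r ^ 2)) fun y r hr => by
        rw [hnorm, fderiv_comp_radialProj_smul hf y hr, inner_grad_eq_fderiv hf]; ring,
    integral_of_separated (n := k + 1) (a := fun y => inner ℝ (y : Ambient (k + 1)) p * f y)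
      (b := fun r => 2 * r * deriv radialBump (r ^ 2)) fun y r hr => by
        rw [hfd, hnorm, hF, Function.comp_apply, radialProj_smul y hr, inner_smul_left]
        simp; ring, integral_radialBump_deriv] at hparts
  have hI : ∫ r in Set.Ioi (0 : ℝ), r ^ (k + 1) * (r⁻¹ * radialBump (r ^ 2)) =
      ∫ r in Set.Ioi (0 : ℝ), r ^ k * radialBump (r ^ 2) := by
    refine setIntegral_congr_fun measurableSet_Ioi fun r hr => ?_
    have : r ≠ 0 := (Set.mem_Ioi.1 hr).ne'
    field_simp
    ring
  rw [hI] at hparts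
  have hpos := integral_radialBump_pos k
  refine mul_right_cancel₀ hpos.ne' (hparts.trans ?_)
  ring

/-! ### Bound from the partial fraction expansion of the cotangent -/

/-- The bound for `(1 - t cot t) / t²` in the remainder of the Hardy inequality. -/
def cotBound (t : ℝ) : ℝ := 2 / (Real.pi ^ 2 - t ^ 2) + 3 / (2 * Real.pi ^ 2)

theorem ofReal_mem_integerComplement {x : ℝ} (h0 : 0 < x) (h1 : x < 1) :
    (x : ℂ) ∈ Complex.integerComplement := by
  rw [Complex.mem_integerComplement_iff]
  rintro ⟨k, hk⟩
  have hk' : (k : ℝ) = x := by exact_mod_cast hk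
  have h2 : (0 : ℝ) < k := hk' ▸ h0
  have h3 : (k : ℝ) < 1 := hk' ▸ h1
  have h4 : 0 < k := by exact_mod_cast h2
  have h5 : k < 1 := by exact_mod_cast h3
  omega

/-- The Mittag-Leffler expansion of π cot(πx), read on the real axis. For 0 < x < 1 all terms are
positive. -/
theorem hasSum_cot {x : ℝ} (h0 : 0 < x) (h1 : x < 1) :
    HasSum (fun k : ℕ => 2 * x / (((k : ℝ) + 1) ^ 2 - x ^ 2))
      (1 / x - Real.pi * Real.cot (Real.pi * x)) := by
  have hx := ofReal_mem_integerComplement h0 h1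
  have h := (summable_cotTerm hx).hasSum
  have hs := cot_series_rep' hx
  have h' : HasSum (fun k : ℕ => cotTerm (x : ℂ) k)
      (Real.pi * Complex.cot (Real.pi * x) - 1 / x) := by
    rw [hs]; exact h
  have h2 := h'.neg
  rw [← Complex.hasSum_ofReal]
  convert! h2 using 1
  · funext k
    rw [cotTerm_identity hx]
    have hk : (0 : ℝ) < ((k : ℝ) + 1) ^ 2 - x ^ 2 := by
      have : (0 : ℝ) ≤ k := k.cast_nonneg
      nlinarith
    have hk' : (((k : ℂ) + 1) ^ 2 - (x : ℂ) ^ 2) ≠ 0 := by exact_mod_cast hk.ne'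
    have h3 : ((x : ℂ) + (k + 1)) * (x - (k + 1)) = -(((k : ℂ) + 1) ^ 2 - (x : ℂ) ^ 2) := by ring
    rw [h3]
    push_cast
    field_simp
  · push_cast
    ring

/-- With j = k + 2 the term is 1/(j-1) - 1/(j+1), so the sum is 1 + 1/2. -/
theorem hasSum_telescope :
    HasSum (fun k : ℕ => 2 / (((k : ℝ) + 2) ^ 2 - 1)) (3 / 2) := by
  have hpart : ∀ N : ℕ, ∑ k ∈ Finset.range N, 2 / (((k : ℝ) + 2) ^ 2 - 1) =
      3 / 2 - 1 / ((N : ℝ) + 1) - 1 / ((N : ℝ) + 2) := by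
    intro N
    induction N with
    | zero => norm_num
    | succ N ih =>
      rw [Finset.sum_range_succ, ih]
      have h1 : ((N : ℝ) + 2) ^ 2 - 1 = (N + 1) * (N + 3) := by ring
      have hN : (0 : ℝ) ≤ N := N.cast_nonneg
      rw [h1]
      push_cast
      field_simp
      ring
  rw [hasSum_iff_tendsto_nat_of_nonneg]
  · simp only [hpart]
    have h1 : Tendsto (fun N : ℕ => 1 / ((N : ℝ) + 1)) atTop (𝓝 0) :=
      tendsto_one_div_add_atTop_nhds_zero_nat
    have h2 : Tendsto (fun N : ℕ => 1 / ((N : ℝ) + 2)) atTop (𝓝 0) := by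
      refine squeeze_zero (fun N => by positivity) (fun N => ?_) h1
      gcongr
      norm_num
    simpa using (tendsto_const_nhds.sub h1).sub h2
  · intro k
    have : (0 : ℝ) ≤ k := k.cast_nonneg
    exact div_nonneg (by norm_num) (by nlinarith)

/-- Only the first term of the expansion blows up as x → 1, and it is kept exactly. In the others x²
< 1 is used in the denominator, which leaves the telescoping series. -/
theorem inv_sub_pi_mul_cot_le {x : ℝ} (h0 : 0 < x) (h1 : x < 1) :
    1 / x - Real.pi * Real.cot (Real.pi * x) ≤ x * (2 / (1 - x ^ 2) + 3 / 2) := by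
  have h := hasSum_cot h0 h1
  have h2 := (hasSum_nat_add_iff' 1).2 h
  have h3 := hasSum_telescope.mul_left x
  have h4 := hasSum_le (fun k => ?_) h2 h3
  · simp at h4
    rw [one_div]
    have : 2 * x / (1 - x ^ 2) = x * (2 / (1 - x ^ 2)) := by ring
    linarith
  · have hk : (0 : ℝ) ≤ k := k.cast_nonneg
    push_cast
    have h5 : (0 : ℝ) < ((k : ℝ) + 2) ^ 2 - 1 := by nlinarith
    have h6 : 2 * x / (((k : ℝ) + 1 + 1) ^ 2 - x ^ 2) = x * (2 / (((k : ℝ) + 2) ^ 2 - x ^ 2)) := by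
      ring
    rw [h6]
    gcongr
    nlinarith

theorem one_div_sq_sub_cot_le {t : ℝ} (h0 : 0 < t) (h1 : t < Real.pi) :
    1 / t ^ 2 - Real.cot t / t ≤ cotBound t := by
  have hpi := Real.pi_pos
  have h := inv_sub_pi_mul_cot_le (div_pos h0 hpi) ((div_lt_one hpi).2 h1)
  rw [mul_div_cancel₀ _ hpi.ne'] at h
  have hd : 0 < Real.pi ^ 2 - t ^ 2 := by nlinarith
  -- With x = t/π, the factor 1/(πt) turns 1/x - π cot t into 1/t² - cot t / t.
  have h2 := mul_le_mul_of_nonneg_left h (one_div_pos.2 (mul_pos hpi h0)).le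
  refine le_trans (le_of_eq ?_) (h2.trans (le_of_eq ?_))
  · field_simp
  · rw [cotBound]
    have h3 : 1 - (t / Real.pi) ^ 2 = (Real.pi ^ 2 - t ^ 2) / Real.pi ^ 2 := by field_simp
    rw [h3]
    field_simp

theorem cotBound_mono {t D : ℝ} (h0 : 0 ≤ t) (h : t ≤ D) (hD : D < Real.pi) :
    cotBound t ≤ cotBound D := by
  unfold cotBound
  have : 0 < Real.pi ^ 2 - D ^ 2 := by nlinarith
  gcongr

theorem cotBound_nonneg {D : ℝ} (h0 : 0 ≤ D) (hD : D < Real.pi) : 0 ≤ cotBound D := by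
  unfold cotBound
  have : 0 < Real.pi ^ 2 - D ^ 2 := by nlinarith
  positivity

theorem hardyConst_eq {n : ℕ} {β : ℝ} (h0 : 0 ≤ β) (h1 : β < Real.pi / 2) :
    hardyConst n β = ((n : ℝ) - 1) * ((n : ℝ) - 2) * cotBound (β + Real.pi / 2) := by
  have hpi := Real.pi_pos
  have : Real.pi ^ 2 - (β + Real.pi / 2) ^ 2 ≠ 0 := by nlinarith
  rw [hardyConst, cotBound]
  congr 1
  generalize β + Real.pi / 2 = D at this
  field_simp
  ring

/-! ### The multipolar inequality for regular profiles -/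

theorem norm_sum_sq_add_sum_norm_sub_sq {E : Type*} [NormedAddCommGroup E]
    [InnerProductSpace ℝ E] {m : ℕ} (Y : Fin m → E) :
    ‖∑ i, Y i‖ ^ 2 + ∑ i, ∑ j ∈ Finset.Ioi i, ‖Y i - Y j‖ ^ 2 = m * ∑ i, ‖Y i‖ ^ 2 := by
  induction m with
  | zero => simp
  | succ m ih =>
    have h := ih fun i => Y i.succ
    rw [Fin.sum_univ_succ, Fin.sum_univ_succ, Fin.sum_univ_succ, Fin.sum_Ioi_zero]
    simp only [Fin.sum_Ioi_succ]
    have h1 : ∑ j : Fin m, ‖Y 0 - Y j.succ‖ ^ 2 =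
        m * ‖Y 0‖ ^ 2 - 2 * inner ℝ (Y 0) (∑ j : Fin m, Y j.succ) + ∑ j : Fin m, ‖Y j.succ‖ ^ 2 := by
      simp only [norm_sub_sq_real, Finset.sum_add_distrib, Finset.sum_sub_distrib, inner_sum,
        Finset.mul_sum]
      simp
    rw [norm_add_sq_real, h1]
    push_cast
    linarith

instance (n : ℕ) : IsFiniteMeasure (sphereVolume n) := by
  unfold sphereVolume; infer_instance

theorem integrable_of_continuous {n : ℕ} {g : UnitSphere n → ℝ} (hg : Continuous g) :
    Integrable g (sphereVolume n) := by
  exact hg.integrable_of_hasCompactSupport (HasCompactSupport.of_compactSpace g)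

theorem contMDiff_inner_sphere {n : ℕ} {k : ℕ∞ω} (p : Ambient n) :
    ContMDiff (𝓡 n) 𝓘(ℝ, ℝ) k fun y : UnitSphere n => (inner ℝ (y : Ambient n) p : ℝ) := by
  have h : ContDiff ℝ k fun x : Ambient n => (inner ℝ x p : ℝ) := contDiff_id.inner ℝ contDiff_const
  exact h.contMDiff.comp contMDiff_coe_sphere

/-- The profile h is regular only for s > -1. This suffices: the support of φ lies in the
hemisphere, which misses the antipode of p, and off that support the product vanishes locally. -/
theorem contMDiff_mul_comp_inner {n : ℕ} {φ : UnitSphere n → ℝ} (hφ : IsTestFunction n φ)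
    {p : UnitSphere n} (hp : p ∈ upperHemisphere n) {h : ℝ → ℝ}
    (hC : ∀ s, -1 < s → ContDiffAt ℝ 1 h s) :
    ContMDiff (𝓡 n) 𝓘(ℝ, ℝ) 1
      fun y : UnitSphere n => φ y * h (inner ℝ (y : Ambient n) (p : Ambient n)) := by
  refine contMDiff_of_tsupport fun y hy => ?_
  have hy' : y ∈ upperHemisphere n := hφ.2 (tsupport_mul_subset_left hy)
  have h1 := (hC _ (neg_one_lt_inner_of_mem_upperHemisphere hy' hp)).contMDiffAt.comp y
    (contMDiff_inner_sphere (p : Ambient n) y)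
  exact (hφ.1.of_le (by simp) y).mul h1

theorem grad_eq_zero_of_eventuallyEq {n : ℕ} {f : UnitSphere n → ℝ} {y : UnitSphere n}
    (hf : f =ᶠ[𝓝 y] 0) : grad n f y = 0 := by
  refine ext_inner_right ℝ fun v => ?_
  rw [inner_grad_of_ambient (F := fun _ => 0) (F' := 0) (hasFDerivAt_const _ _) hf]
  simp

/-- The pointwise form of the Leibniz rule for `φ² h(⟨·, p⟩)`. -/
theorem inner_grad_mul_comp_inner {n : ℕ} {φ : UnitSphere n → ℝ}
    (hφ : ContMDiff (𝓡 n) 𝓘(ℝ, ℝ) 1 φ) {p y : UnitSphere n} {h : ℝ → ℝ}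
    (hC : DifferentiableAt ℝ h (inner ℝ (y : Ambient n) (p : Ambient n))) :
    inner ℝ (grad n (fun y : UnitSphere n =>
        φ y * h (inner ℝ (y : Ambient n) (p : Ambient n)) * φ y) y) (p : Ambient n) =
      2 * (φ y * h (inner ℝ (y : Ambient n) (p : Ambient n)) *
        inner ℝ (grad n φ y) (p : Ambient n)) +
      φ y ^ 2 * (deriv h (inner ℝ (y : Ambient n) (p : Ambient n)) *
        (1 - inner ℝ (y : Ambient n) (p : Ambient n) ^ 2)) := by
  set s : ℝ := inner ℝ (y : Ambient n) (p : Ambient n) with hs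
  have h1 := ((contDiffAt_comp_radialProj hφ (sphere_ne_zero y)).differentiableAt
    one_ne_zero).hasFDerivAt
  have h2 : HasFDerivAt (fun x : Ambient n => (inner ℝ x (p : Ambient n) : ℝ))
      (innerSL ℝ (p : Ambient n)) (y : Ambient n) := by
    refine ((innerSL ℝ (p : Ambient n)).hasFDerivAt (x := (y : Ambient n))).congr_of_eventuallyEq
      (Eventually.of_forall fun x => ?_)
    simp [real_inner_comm]
  have h3 := HasDerivAt.comp_hasFDerivAt (h₂ := h) (y : Ambient n) hC.hasDerivAt h2
  have h4 := (h1.mul h3).mul h1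
  rw [inner_grad_of_ambient h4 (Eventually.of_forall fun z => by simp), inner_grad_eq_fderiv hφ]
  have h5 : fderiv ℝ (φ ∘ radialProj n) (y : Ambient n)
      ((p : Ambient n) - inner ℝ (y : Ambient n) (p : Ambient n) • (y : Ambient n)) =
      fderiv ℝ (φ ∘ radialProj n) (y : Ambient n) (p : Ambient n) := by
    rw [map_sub, map_smul, fderiv_comp_radialProj_self]; simp
  have h6 : (inner ℝ (p : Ambient n)
      ((p : Ambient n) - inner ℝ (y : Ambient n) (p : Ambient n) • (y : Ambient n)) : ℝ) =
      1 - s ^ 2 := by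
    rw [inner_sub_right, inner_smul_right, inner_self_sphere, real_inner_comm (y : Ambient n)]; ring
  simp only [add_apply, smul_apply, h5, innerSL_apply_apply, h6, smul_eq_mul, Pi.mul_apply,
    Function.comp_apply, radialProj_coe]
  rw [← hs]
  ring

theorem norm_smul_sub_inner_smul_sq {n : ℕ} (a : ℝ) (y p : UnitSphere n) :
    ‖a • ((p : Ambient n) - inner ℝ (y : Ambient n) (p : Ambient n) • (y : Ambient n))‖ ^ 2 =
      a ^ 2 * (1 - inner ℝ (y : Ambient n) (p : Ambient n) ^ 2) := by
  rw [norm_smul, mul_pow, norm_sub_inner_smul_sq, Real.norm_eq_abs, sq_abs]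

/-- The field `φ h(⟨·, p⟩) ∇⟨·, p⟩`. -/
def poleField (n : ℕ) (φ : UnitSphere n → ℝ) (h : ℝ → ℝ) (p y : UnitSphere n) : Ambient n :=
  (φ y * h (inner ℝ (y : Ambient n) (p : Ambient n))) •
    ((p : Ambient n) - inner ℝ (y : Ambient n) (p : Ambient n) • (y : Ambient n))

theorem continuous_poleField {n : ℕ} {φ : UnitSphere n → ℝ} (hφ : IsTestFunction n φ)
    {p : UnitSphere n} (hp : p ∈ upperHemisphere n) {h : ℝ → ℝ}
    (hC : ∀ s, -1 < s → ContDiffAt ℝ 1 h s) : Continuous (poleField n φ h p) := by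
  have h1 := (contMDiff_mul_comp_inner hφ hp hC).continuous
  unfold poleField
  fun_prop

theorem inner_grad_poleField {n : ℕ} (φ : UnitSphere n → ℝ) (h : ℝ → ℝ) (p y : UnitSphere n) :
    inner ℝ (grad n φ y) (poleField n φ h p y) =
      φ y * h (inner ℝ (y : Ambient n) (p : Ambient n)) *
        inner ℝ (grad n φ y) (p : Ambient n) := by
  rw [poleField, inner_smul_right, inner_sub_right, inner_smul_right,
    real_inner_comm (y : Ambient n) (grad n φ y), inner_grad_self]
  ring

/-- The divergence theorem for f = φ² h(⟨·, p⟩) trades 2⟨∇φ, Y⟩ for φ² (n s h - h'(1 - s²)), and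
|Y|² = φ² h² (1 - s²). The hypothesis on h is then exactly the pointwise bound needed. -/
theorem integral_inner_grad_poleField_ge {n : ℕ} (hn : 1 ≤ n) {φ : UnitSphere n → ℝ}
    (hφ : IsTestFunction n φ) {p : UnitSphere n} (hp : p ∈ upperHemisphere n) {h : ℝ → ℝ}
    (hC : ∀ s, -1 < s → ContDiffAt ℝ 1 h s) {κ : ℝ}
    (hκ : ∀ y ∈ upperHemisphere n, ∀ s : ℝ, s = inner ℝ (y : Ambient n) (p : Ambient n) →
      -κ ≤ n * s * h s - deriv h s * (1 - s ^ 2) - (n - 2) * (h s ^ 2 * (1 - s ^ 2))) :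
    -κ * ∫ y, φ y ^ 2 ∂(sphereVolume n) ≤
      ∫ y, (2 * inner ℝ (grad n φ y) (poleField n φ h p y) -
        (n - 2) * ‖poleField n φ h p y‖ ^ 2) ∂(sphereVolume n) := by
  have hφ1 : ContMDiff (𝓡 n) 𝓘(ℝ, ℝ) 1 φ := hφ.1.of_le (by simp)
  have ha := contMDiff_mul_comp_inner hφ hp hC
  have hf := ha.mul hφ1
  set f : UnitSphere n → ℝ := fun y =>
    φ y * h (inner ℝ (y : Ambient n) (p : Ambient n)) * φ y with hfdef
  have hdiv := integral_inner_grad (f := f) hf hn (p : Ambient n)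
  have hcs : Continuous fun y : UnitSphere n => (inner ℝ (y : Ambient n) (p : Ambient n) : ℝ) :=
    continuous_subtype_val.inner continuous_const
  have hi1 : Integrable (fun y => inner ℝ (grad n f y) (p : Ambient n)) (sphereVolume n) :=
    integrable_of_continuous ((continuous_grad (f := f) hf).inner continuous_const)
  have hi2 : Integrable (fun y : UnitSphere n =>
      n * (inner ℝ (y : Ambient n) (p : Ambient n) * f y)) (sphereVolume n) :=
    integrable_of_continuous (continuous_const.mul (hcs.mul hf.continuous))
  have hi3 : Integrable (fun y => 2 * inner ℝ (grad n φ y) (poleField n φ h p y) -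
        (n - 2) * ‖poleField n φ h p y‖ ^ 2) (sphereVolume n) := by
    have hY := continuous_poleField hφ hp hC
    exact integrable_of_continuous ((continuous_const.mul ((continuous_grad hφ1).inner hY)).sub
      (continuous_const.mul (hY.norm.pow 2)))
  have hi4 : Integrable (fun y => -κ * φ y ^ 2) (sphereVolume n) :=
    integrable_of_continuous (continuous_const.mul (hφ.1.continuous.pow 2))
  -- The added bracket n s f - ⟨∇f, p⟩ has integral 0. Off the support of φ, where h is not
  -- controlled, every term vanishes.
  have hpt : ∀ y, -κ * φ y ^ 2 ≤ (2 * inner ℝ (grad n φ y) (poleField n φ h p y) -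
        (n - 2) * ‖poleField n φ h p y‖ ^ 2) +
        (n * (inner ℝ (y : Ambient n) (p : Ambient n) * f y) -
          inner ℝ (grad n f y) (p : Ambient n)) := by
    intro y
    rw [inner_grad_poleField, poleField, norm_smul_sub_inner_smul_sq]
    by_cases hy : y ∈ tsupport φ
    · have hy' := hφ.2 hy
      rw [hfdef, inner_grad_mul_comp_inner hφ1 ((hC _
        (neg_one_lt_inner_of_mem_upperHemisphere hy' hp)).differentiableAt one_ne_zero)]
      have h1 := mul_le_mul_of_nonneg_left (hκ y hy' _ rfl) (sq_nonneg (φ y))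
      linarith
    · have h0 : φ y = 0 := image_eq_zero_of_notMem_tsupport hy
      have h1 : f =ᶠ[𝓝 y] 0 := by
        filter_upwards [notMem_tsupport_iff_eventuallyEq.1 hy] with z hz
        simp [hfdef, hz]
      rw [grad_eq_zero_of_eventuallyEq h1]
      simp [hfdef, h0]
  have hint := integral_mono hi4 (hi3.add (hi2.sub hi1)) hpt
  rw [integral_const_mul] at hint
  refine hint.trans (le_of_eq ?_)
  have h5 := integral_add hi3 (hi2.sub hi1)
  have h6 := integral_sub hi2 hi1
  simp only [Pi.add_apply, Pi.sub_apply] at h5 ⊢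
  rw [h5, h6, integral_const_mul, hdiv, sub_self, add_zero]

/-- The multipolar inequality for regularized fields. -/
theorem integral_sum_norm_poleField_sub_sq_le {n m : ℕ} (hn : 3 ≤ n) (hm : 0 < m)
    {φ : UnitSphere n → ℝ} (hφ : IsTestFunction n φ) {p : Fin m → UnitSphere n}
    (hp : ∀ i, p i ∈ upperHemisphere n) {h : ℝ → ℝ}
    (hC : ∀ s, -1 < s → ContDiffAt ℝ 1 h s) {κ : ℝ}
    (hκ : ∀ i, ∀ y ∈ upperHemisphere n, ∀ s : ℝ,
      s = inner ℝ (y : Ambient n) (p i : Ambient n) →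
      -κ ≤ n * s * h s - deriv h s * (1 - s ^ 2) - (n - 2) * (h s ^ 2 * (1 - s ^ 2))) :
    ∫ y, ((n : ℝ) - 2) ^ 2 / (m : ℝ) ^ 2 * ∑ i, ∑ j ∈ Finset.Ioi i,
        ‖poleField n φ h (p i) y - poleField n φ h (p j) y‖ ^ 2 ∂(sphereVolume n) ≤
      ∫ y, ‖grad n φ y‖ ^ 2 ∂(sphereVolume n) + (n - 2) * κ * ∫ y, φ y ^ 2 ∂(sphereVolume n) := by
  have hφ1 : ContMDiff (𝓡 n) 𝓘(ℝ, ℝ) 1 φ := hφ.1.of_le (by simp)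
  have hm' : (0 : ℝ) < m := by exact_mod_cast hm
  have hn' : (3 : ℝ) ≤ n := by exact_mod_cast hn
  -- The choice c m = n - 2 makes c² m Σ |Y_i|² equal to c (n-2) Σ |Y_i|², the quadratic term of c Σ
  -- Q_i.
  set c : ℝ := ((n : ℝ) - 2) / m with hc
  have hc0 : 0 ≤ c := div_nonneg (by linarith) hm'.le
  have hcm : c * m = n - 2 := by rw [hc]; field_simp
  set Y : Fin m → UnitSphere n → Ambient n := fun i => poleField n φ h (p i) with hYdef
  have hY : ∀ i, Continuous (Y i) := fun i => continuous_poleField hφ (hp i) hC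
  have hg := continuous_grad hφ1
  set Q : Fin m → UnitSphere n → ℝ := fun i y =>
    2 * inner ℝ (grad n φ y) (Y i y) - (n - 2) * ‖Y i y‖ ^ 2 with hQ
  have hQi : ∀ i, Integrable (Q i) (sphereVolume n) := fun i =>
    integrable_of_continuous ((continuous_const.mul (hg.inner (hY i))).sub
      (continuous_const.mul ((hY i).norm.pow 2)))
  have hpt : ∀ y, ((n : ℝ) - 2) ^ 2 / (m : ℝ) ^ 2 *
      ∑ i, ∑ j ∈ Finset.Ioi i, ‖Y i y - Y j y‖ ^ 2 ≤ ‖grad n φ y‖ ^ 2 - c * ∑ i, Q i y := by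
    intro y
    have h1 : 0 ≤ ‖grad n φ y - c • ∑ i, Y i y‖ ^ 2 := sq_nonneg _
    have h2 := norm_sum_sq_add_sum_norm_sub_sq fun i => Y i y
    rw [norm_sub_sq_real, inner_smul_right, norm_smul, Real.norm_of_nonneg hc0, mul_pow,
      inner_sum] at h1
    have h3 : ∑ i, Q i y = 2 * ∑ i, inner ℝ (grad n φ y) (Y i y) -
        (n - 2) * ∑ i, ‖Y i y‖ ^ 2 := by
      simp only [hQ, Finset.sum_sub_distrib, Finset.mul_sum]
    rw [← div_pow, ← hc, h3]
    have h4 : c ^ 2 * ∑ i, ∑ j ∈ Finset.Ioi i, ‖Y i y - Y j y‖ ^ 2 =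
        c * (c * m) * ∑ i, ‖Y i y‖ ^ 2 - c ^ 2 * ‖∑ i, Y i y‖ ^ 2 := by
      linear_combination c ^ 2 * h2
    rw [h4, hcm]
    linarith
  have hi1 : Integrable (fun y => ‖grad n φ y‖ ^ 2) (sphereVolume n) :=
    integrable_of_continuous (hg.norm.pow 2)
  have hi2 : Integrable (fun y => c * ∑ i, Q i y) (sphereVolume n) :=
    (integrable_finsetSum _ fun i _ => hQi i).const_mul c
  have hint := integral_mono (integrable_of_continuous (continuous_const.mul
    (continuous_finsetSum _ fun i _ => continuous_finsetSum _ fun j _ =>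
      ((hY i).sub (hY j)).norm.pow 2))) (hi1.sub hi2) hpt
  refine hint.trans ?_
  have h5 := integral_sub hi1 hi2
  simp only [Pi.sub_apply] at h5 ⊢
  rw [h5, integral_const_mul, integral_finsetSum _ fun i _ => hQi i]
  have h6 : ∑ _i : Fin m, -κ * ∫ y, φ y ^ 2 ∂(sphereVolume n) ≤
      ∑ i, ∫ y, Q i y ∂(sphereVolume n) :=
    Finset.sum_le_sum fun i _ =>
      integral_inner_grad_poleField_ge (by omega) hφ (hp i) hC (hκ i)
  rw [Finset.sum_const, Finset.card_univ, Fintype.card_fin, nsmul_eq_mul] at h6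
  have h7 := mul_le_mul_of_nonneg_left h6 hc0
  have h8 : c * (m * (-κ * ∫ y, φ y ^ 2 ∂(sphereVolume n))) =
      -((n - 2) * κ * ∫ y, φ y ^ 2 ∂(sphereVolume n)) := by
    rw [← hcm]; ring
  linarith

/-! ### The singular profile and its cutoff -/

/-- The factor `1 / (sin θ · θ)` as a function of `s = cos θ`. -/
def poleProfile (s : ℝ) : ℝ := (√(1 - s ^ 2) * Real.arccos s)⁻¹

/-- A smooth cutoff that vanishes for `s ≥ 1 - ε` and equals `1` for `s ≤ 1 - 2 ε`. -/
def poleCutoff (ε s : ℝ) : ℝ := Real.smoothTransition ((1 - s) / ε - 1)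

theorem poleCutoff_eq_zero {ε s : ℝ} (hε : 0 < ε) (hs : 1 - ε ≤ s) : poleCutoff ε s = 0 := by
  apply Real.smoothTransition.zero_of_nonpos
  rw [sub_nonpos, div_le_one hε]
  linarith

theorem poleCutoff_eq_one {ε s : ℝ} (hε : 0 < ε) (hs : s ≤ 1 - 2 * ε) : poleCutoff ε s = 1 := by
  apply Real.smoothTransition.one_of_one_le
  rw [le_sub_iff_add_le, le_div_iff₀ hε]
  linarith

theorem contDiff_poleCutoff (ε : ℝ) : ContDiff ℝ 1 (poleCutoff ε) :=
  Real.smoothTransition.contDiff.comp (((contDiff_const.sub contDiff_id).div_const ε).sub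
    contDiff_const)

theorem deriv_poleCutoff_nonpos {ε : ℝ} (hε : 0 < ε) (s : ℝ) : deriv (poleCutoff ε) s ≤ 0 := by
  refine Antitone.deriv_nonpos fun a b hab => ?_
  apply Real.smoothTransition.monotone
  gcongr

/-- The regularization of `poleProfile` that vanishes near `s = 1`. -/
def cutoffProfile (ε s : ℝ) : ℝ := poleCutoff ε s * poleProfile s

theorem sqrt_one_sub_sq_pos {s : ℝ} (h0 : -1 < s) (h1 : s < 1) : 0 < √(1 - s ^ 2) :=
  Real.sqrt_pos.2 (by nlinarith)

theorem cutoffProfile_eventuallyEq_zero {ε s : ℝ} (hε : 0 < ε) (hs : 1 - ε < s) :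
    cutoffProfile ε =ᶠ[𝓝 s] 0 := by
  filter_upwards [Ioi_mem_nhds hs] with t ht
  simp [cutoffProfile, poleCutoff_eq_zero hε (Set.mem_Ioi.1 ht).le]

theorem contDiffAt_cutoffProfile {ε : ℝ} (hε : 0 < ε) (s : ℝ) (h0 : -1 < s) :
    ContDiffAt ℝ 1 (cutoffProfile ε) s := by
  rcases lt_or_ge s 1 with h1 | h1
  · have hr := sqrt_one_sub_sq_pos h0 h1
    have hθ : 0 < Real.arccos s := Real.arccos_pos.2 h1
    refine (contDiff_poleCutoff ε).contDiffAt.mul (ContDiffAt.inv (ContDiffAt.mul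
      (ContDiffAt.sqrt (contDiffAt_const.sub (contDiffAt_id.pow 2)) ?_)
        (Real.contDiffAt_arccos h0.ne' h1.ne)) (mul_pos hr hθ).ne')
    exact (Real.sqrt_pos.1 hr).ne'
  · exact contDiffAt_const.congr_of_eventuallyEq
      (cutoffProfile_eventuallyEq_zero hε (by linarith))

theorem hasDerivAt_poleProfile {s : ℝ} (h0 : -1 < s) (h1 : s < 1) :
    HasDerivAt poleProfile ((s * Real.arccos s / √(1 - s ^ 2) + 1) /
      ((1 - s ^ 2) * Real.arccos s ^ 2)) s := by
  have hr := sqrt_one_sub_sq_pos h0 h1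
  have hθ : 0 < Real.arccos s := Real.arccos_pos.2 h1
  have h2 : HasDerivAt (fun s : ℝ => 1 - s ^ 2) (-(2 * s)) s := by
    simpa using (hasDerivAt_pow 2 s).const_sub 1
  have h3 := ((h2.sqrt (Real.sqrt_pos.1 hr).ne').mul
    (Real.hasDerivAt_arccos h0.ne' h1.ne)).inv (mul_pos hr hθ).ne'
  refine h3.congr_deriv ?_
  rw [Pi.mul_apply, mul_pow, Real.sq_sqrt (Real.sqrt_pos.1 hr).le]
  have h4 : 1 - s ^ 2 ≠ 0 := (Real.sqrt_pos.1 hr).ne'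
  field_simp
  ring

/-- For s < 1 the right side splits into -χ' r/θ, (n-2) χ(1-χ)/θ² and -(n-1) χ (1/θ² - cot θ/θ),
where r = sin θ. The first two are nonnegative since χ decreases with values in [0, 1]; the last is
the cotangent bound, uniform in ε. For s ≥ 1 the profile vanishes locally. -/
theorem cutoffProfile_ineq {n : ℕ} (hn : 3 ≤ n) {ε D s : ℝ} (hε : 0 < ε) (hD : D < Real.pi)
    (h0 : -1 < s) (hsD : Real.arccos s ≤ D) :
    -((n - 1) * cotBound D) ≤ n * s * cutoffProfile ε s -
      deriv (cutoffProfile ε) s * (1 - s ^ 2) -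
      (n - 2) * (cutoffProfile ε s ^ 2 * (1 - s ^ 2)) := by
  have hn' : (3 : ℝ) ≤ n := by exact_mod_cast hn
  have hD0 : 0 ≤ D := (Real.arccos_nonneg s).trans hsD
  have hK := cotBound_nonneg hD0 hD
  rcases lt_or_ge s 1 with h1 | h1
  · have hr := sqrt_one_sub_sq_pos h0 h1
    have hθ : 0 < Real.arccos s := Real.arccos_pos.2 h1
    have hcot := (one_div_sq_sub_cot_le hθ (hsD.trans_lt hD)).trans
      (cotBound_mono hθ.le hsD hD)
    rw [Real.cot_eq_cos_div_sin, Real.cos_arccos h0.le h1.le, Real.sin_arccos] at hcot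
    have hd := (((contDiff_poleCutoff ε).differentiable one_ne_zero s).hasDerivAt.mul
      (hasDerivAt_poleProfile h0 h1)).deriv
    have hd' : deriv (cutoffProfile ε) s = _ := hd
    rw [hd', cutoffProfile, poleProfile]
    set χ := poleCutoff ε s with hχ
    set χ' := deriv (poleCutoff ε) s with hχ'
    have hχ0 : 0 ≤ χ := Real.smoothTransition.nonneg _
    have hχ1 : χ ≤ 1 := Real.smoothTransition.le_one _
    have hχ'0 : χ' ≤ 0 := deriv_poleCutoff_nonpos hε s
    set r := √(1 - s ^ 2) with hrdef
    set θ := Real.arccos s with hθdef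
    have hr2 : 1 - s ^ 2 = r ^ 2 := (Real.sq_sqrt (Real.sqrt_pos.1 hr).le).symm
    rw [hr2]
    have key : n * s * (χ * (r * θ)⁻¹) -
        (χ' * (r * θ)⁻¹ + χ * ((s * θ / r + 1) / (r ^ 2 * θ ^ 2))) * r ^ 2 -
        (n - 2) * ((χ * (r * θ)⁻¹) ^ 2 * r ^ 2) =
        -χ' * (r / θ) + (n - 2) * (χ * (1 - χ) / θ ^ 2) -
          (n - 1) * (χ * (1 / θ ^ 2 - s / r / θ)) := by
      field_simp
      ring
    rw [key]
    have t1 : 0 ≤ -χ' * (r / θ) := mul_nonneg (by linarith) (div_pos hr hθ).le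
    have t2 : 0 ≤ (n - 2) * (χ * (1 - χ) / θ ^ 2) :=
      mul_nonneg (by linarith) (div_nonneg (mul_nonneg hχ0 (by linarith)) (sq_nonneg θ))
    have t3 : χ * (1 / θ ^ 2 - s / r / θ) ≤ cotBound D := by
      calc _ ≤ χ * cotBound D := by gcongr
        _ ≤ 1 * cotBound D := by gcongr
        _ = _ := one_mul _
    have t4 := mul_le_mul_of_nonneg_left t3 (show (0 : ℝ) ≤ n - 1 by linarith)
    linarith
  · have h2 := cutoffProfile_eventuallyEq_zero hε (show 1 - ε < s by linarith)
    rw [h2.eq_of_nhds, h2.deriv_eq]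
    have : 0 ≤ ((n : ℝ) - 1) * cotBound D := mul_nonneg (by linarith) hK
    simpa using this

theorem eventually_cutoffProfile_eq {s : ℝ} (h1 : s < 1) :
    ∀ᶠ k : ℕ in atTop, cutoffProfile (1 / ((k : ℝ) + 1)) s = poleProfile s := by
  have h : ∀ᶠ k : ℕ in atTop, 1 / ((k : ℝ) + 1) < (1 - s) / 2 :=
    tendsto_one_div_add_atTop_nhds_zero_nat.eventually (Iio_mem_nhds (by linarith))
  filter_upwards [h] with k hk
  rw [cutoffProfile, poleCutoff_eq_one (by positivity) (by linarith), one_mul]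

/-! ### Null sets and the closed form of the potential -/

open scoped Pointwise in
theorem sphereVolume_singleton {n : ℕ} (hn : 1 ≤ n) (p : UnitSphere n) :
    sphereVolume n {p} = 0 := by
  rw [sphereVolume, Measure.toSphere_apply' _ (measurableSet_singleton p)]
  -- The cone over a point lies in a line, a proper subspace because the ambient dimension is at
  -- least 2, hence Lebesgue null.
  have hne : (ℝ ∙ (p : Ambient n)) ≠ ⊤ := by
    intro h
    have h1 := finrank_span_singleton (K := ℝ) (sphere_ne_zero p)
    rw [h, finrank_top] at h1
    simp at h1
    omega
  have h0 := Measure.addHaar_submodule (volume : Measure (Ambient n)) _ hne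
  have hsub : Set.Ioo (0 : ℝ) 1 • ((↑) '' ({p} : Set (UnitSphere n)) : Set (Ambient n)) ⊆
      ((ℝ ∙ (p : Ambient n) : Submodule ℝ (Ambient n)) : Set (Ambient n)) := by
    rintro _ ⟨r, -, _, ⟨_, rfl, rfl⟩, rfl⟩
    exact Submodule.smul_mem _ _ (Submodule.mem_span_singleton_self _)
  rw [measure_mono_null hsub h0, mul_zero]

theorem ae_ne_hemisphereVolume {n : ℕ} (hn : 1 ≤ n) (p : UnitSphere n) :
    ∀ᵐ y ∂(hemisphereVolume n), y ≠ p := by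
  refine ae_restrict_of_ae ?_
  rw [ae_iff]
  simpa using sphereVolume_singleton hn p

theorem isOpen_upperHemisphere (n : ℕ) : IsOpen (upperHemisphere n) := by
  have h : Continuous fun y : UnitSphere n => (y : Ambient n) (Fin.last n) := by fun_prop
  exact isOpen_lt continuous_const h

theorem ae_mem_upperHemisphere (n : ℕ) :
    ∀ᵐ y ∂(hemisphereVolume n), y ∈ upperHemisphere n :=
  ae_restrict_mem (isOpen_upperHemisphere n).measurableSet

instance (n : ℕ) : IsFiniteMeasure (hemisphereVolume n) := by
  unfold hemisphereVolume; infer_instance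

theorem inner_lt_one_of_ne {n : ℕ} {y p : UnitSphere n} (h : y ≠ p) :
    inner ℝ (y : Ambient n) (p : Ambient n) < 1 :=
  lt_of_le_of_ne (inner_le_one_sphere y p) fun h1 =>
    h (Subtype.ext ((inner_eq_one_iff_of_norm_eq_one (norm_sphere y) (norm_sphere p)).1 h1))

/-- The field `∇d / d` up to sign, in closed form. -/
def poleVector (n : ℕ) (p y : UnitSphere n) : Ambient n :=
  poleProfile (inner ℝ (y : Ambient n) (p : Ambient n)) •
    ((p : Ambient n) - inner ℝ (y : Ambient n) (p : Ambient n) • (y : Ambient n))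

theorem measurable_poleVector (n : ℕ) (p : UnitSphere n) : Measurable (poleVector n p) := by
  have h1 : Measurable poleProfile := by
    unfold poleProfile
    exact ((continuous_const.sub (continuous_pow 2)).sqrt.measurable.mul
      Real.continuous_arccos.measurable).inv
  have h2 : Continuous fun y : UnitSphere n => (inner ℝ (y : Ambient n) (p : Ambient n) : ℝ) :=
    continuous_subtype_val.inner continuous_const
  have h3 : Continuous fun y : UnitSphere n =>
      (p : Ambient n) - inner ℝ (y : Ambient n) (p : Ambient n) • (y : Ambient n) := by fun_prop
  exact (h1.comp h2.measurable).smul h3.measurable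

theorem inv_geodDist_smul_grad {n : ℕ} {y p : UnitSphere n} (hy : y ∈ upperHemisphere n)
    (hp : p ∈ upperHemisphere n) (hne : y ≠ p) :
    (geodDist n y p)⁻¹ • grad n (fun z => geodDist n z p) y = -poleVector n p y := by
  have h0 := neg_one_lt_inner_of_mem_upperHemisphere hy hp
  rw [grad_geodDist h0 (inner_lt_one_of_ne hne), geodDist_eq_arccos h0, smul_smul, poleVector,
    poleProfile, mul_inv, ← neg_smul]
  congr 1
  ring

/-- The closed form of ∇d/d fails only at the poles, which are null. Its sign drops out of the norm
of the difference. -/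
theorem bipolarPotential_ae_eq {n : ℕ} (hn : 1 ≤ n) {p q : UnitSphere n}
    (hp : p ∈ upperHemisphere n) (hq : q ∈ upperHemisphere n) :
    bipolarPotential n p q =ᵐ[hemisphereVolume n]
      fun y => ‖poleVector n p y - poleVector n q y‖ ^ 2 := by
  filter_upwards [ae_ne_hemisphereVolume hn p, ae_ne_hemisphereVolume hn q,
    ae_mem_upperHemisphere n] with y h1 h2 hy
  rw [bipolarPotential, inv_geodDist_smul_grad hy hp h1, inv_geodDist_smul_grad hy hq h2,
    neg_sub_neg, norm_sub_rev]

/-! ### Fatou limits: removing the cutoff, then density -/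

theorem lintegral_le_of_tendsto_ae {α : Type*} [MeasurableSpace α] {μ : Measure α}
    {f : ℕ → α → ENNReal} {g : α → ENNReal} {B : ℕ → ENNReal} {b : ENNReal}
    (hf : ∀ k, AEMeasurable (f k) μ) (hg : ∀ᵐ x ∂μ, Tendsto (fun k => f k x) atTop (𝓝 (g x)))
    (hB : ∀ k, ∫⁻ x, f k x ∂μ ≤ B k) (hb : Tendsto B atTop (𝓝 b)) : ∫⁻ x, g x ∂μ ≤ b := by
  calc ∫⁻ x, g x ∂μ = ∫⁻ x, liminf (fun k => f k x) atTop ∂μ :=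
        lintegral_congr_ae (hg.mono fun x hx => hx.liminf_eq.symm)
    _ ≤ liminf (fun k => ∫⁻ x, f k x ∂μ) atTop := lintegral_liminf_le' hf
    _ ≤ liminf B atTop := liminf_le_liminf (Eventually.of_forall hB)
    _ = b := hb.liminf_eq

theorem ofReal_integral_norm_sq {α E : Type*} [MeasurableSpace α] {μ : Measure α}
    [NormedAddCommGroup E] {g : α → E} (hg : MemLp g 2 μ) :
    ENNReal.ofReal (∫ x, ‖g x‖ ^ 2 ∂μ) = eLpNorm g 2 μ ^ 2 := by
  have h := eLpNorm_nnreal_pow_eq_lintegral (f := g) (μ := μ) (p := 2) two_ne_zero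
  simp only [NNReal.coe_ofNat, ENNReal.coe_ofNat, ENNReal.rpow_ofNat] at h
  rw [h, ofReal_integral_eq_lintegral_ofReal (hg.integrable_norm_pow two_ne_zero)
    (Eventually.of_forall fun x => sq_nonneg _)]
  refine lintegral_congr fun x => ?_
  rw [ENNReal.ofReal_pow (norm_nonneg _), ofReal_norm]

/-- The weighted potential energy density `(n-2)²/m² Σ_{i<j} |W_i - W_j|² u²`. -/
def hardyDensity (n : ℕ) {m : ℕ} (p : Fin m → UnitSphere n) (u : UnitSphere n → ℝ)
    (y : UnitSphere n) : ℝ :=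
  ((n : ℝ) - 2) ^ 2 / (m : ℝ) ^ 2 * ∑ i, ∑ j ∈ Finset.Ioi i,
    ‖poleVector n (p i) y - poleVector n (p j) y‖ ^ 2 * u y ^ 2

theorem hardyDensity_nonneg {n m : ℕ} (p : Fin m → UnitSphere n) (u : UnitSphere n → ℝ)
    (y : UnitSphere n) : 0 ≤ hardyDensity n p u y := by
  unfold hardyDensity
  positivity

theorem aemeasurable_hardyDensity {n m : ℕ} (p : Fin m → UnitSphere n) {u : UnitSphere n → ℝ}
    {μ : Measure (UnitSphere n)} (hu : AEMeasurable u μ) :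
    AEMeasurable (hardyDensity n p u) μ := by
  unfold hardyDensity
  refine AEMeasurable.const_mul (Finset.aemeasurable_fun_sum _ fun i _ =>
    Finset.aemeasurable_fun_sum _ fun j _ => ?_) _
  exact (((measurable_poleVector n _).sub (measurable_poleVector n _)).norm.pow_const
    2).aemeasurable.mul (hu.pow_const 2)

theorem cutoff_density_eventuallyEq {n m : ℕ} (p : Fin m → UnitSphere n)
    (φ : UnitSphere n → ℝ) {y : UnitSphere n} (hy : ∀ i, y ≠ p i) :
    ∀ᶠ k : ℕ in atTop, ((n : ℝ) - 2) ^ 2 / (m : ℝ) ^ 2 * ∑ i, ∑ j ∈ Finset.Ioi i,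
        ‖poleField n φ (cutoffProfile (1 / ((k : ℝ) + 1))) (p i) y -
          poleField n φ (cutoffProfile (1 / ((k : ℝ) + 1))) (p j) y‖ ^ 2 =
      hardyDensity n p φ y := by
  have h : ∀ᶠ k : ℕ in atTop, ∀ i, cutoffProfile (1 / ((k : ℝ) + 1))
      (inner ℝ (y : Ambient n) (p i : Ambient n)) =
        poleProfile (inner ℝ (y : Ambient n) (p i : Ambient n)) :=
    eventually_all.2 fun i => eventually_cutoffProfile_eq (inner_lt_one_of_ne (hy i))
  filter_upwards [h] with k hk
  have h1 : ∀ i, poleField n φ (cutoffProfile (1 / ((k : ℝ) + 1))) (p i) y =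
      φ y • poleVector n (p i) y := fun i => by
    rw [poleField, hk, poleVector, smul_smul]
  rw [hardyDensity]
  congr 1
  refine Finset.sum_congr rfl fun i _ => Finset.sum_congr rfl fun j _ => ?_
  rw [h1, h1, ← smul_sub, norm_smul, mul_pow, Real.norm_eq_abs, sq_abs, mul_comm]

theorem setIntegral_hemisphere_eq {n : ℕ} {φ : UnitSphere n → ℝ} (hφ : IsTestFunction n φ)
    {g : UnitSphere n → ℝ} (hg : ∀ y, y ∉ tsupport φ → g y = 0) :
    ∫ y, g y ∂(sphereVolume n) = ∫ y, g y ∂(hemisphereVolume n) :=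
  (setIntegral_eq_integral_of_forall_compl_eq_zero fun y hy => hg y fun h => hy (hφ.2 h)).symm

/-- The multipolar Hardy inequality for test functions. -/
theorem lintegral_hardyDensity_le {n m : ℕ} (hn : 3 ≤ n) (hm : 0 < m)
    {φ : UnitSphere n → ℝ} (hφ : IsTestFunction n φ) {p : Fin m → UnitSphere n}
    (hp : ∀ i, p i ∈ upperHemisphere n) {D : ℝ} (hD0 : 0 ≤ D) (hD : D < Real.pi)
    (hpD : ∀ i, ∀ y ∈ upperHemisphere n,
      Real.arccos (inner ℝ (y : Ambient n) (p i : Ambient n)) ≤ D) :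
    ∫⁻ y, ENNReal.ofReal (hardyDensity n p φ y) ∂(hemisphereVolume n) ≤
      eLpNorm (grad n φ) 2 (hemisphereVolume n) ^ 2 +
        ENNReal.ofReal ((n - 1) * (n - 2) * cotBound D) *
          eLpNorm φ 2 (hemisphereVolume n) ^ 2 := by
  have hn' : (3 : ℝ) ≤ n := by exact_mod_cast hn
  have hκ0 : 0 ≤ ((n : ℝ) - 1) * (n - 2) * cotBound D :=
    mul_nonneg (mul_nonneg (by linarith) (by linarith)) (cotBound_nonneg hD0 hD)
  have hgrad := continuous_grad (hφ.1.of_le (by simp : (1 : ℕ∞ω) ≤ ∞))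
  have hL1 : MemLp (grad n φ) 2 (hemisphereVolume n) :=
    hgrad.memLp_of_hasCompactSupport (HasCompactSupport.of_compactSpace _)
  have hL2 : MemLp φ 2 (hemisphereVolume n) :=
    hφ.1.continuous.memLp_of_hasCompactSupport (HasCompactSupport.of_compactSpace _)
  set μ := hemisphereVolume n with hμ
  have hε : ∀ k : ℕ, (0 : ℝ) < 1 / ((k : ℝ) + 1) := fun k => by positivity
  have hcont : ∀ k : ℕ, Continuous fun y => ((n : ℝ) - 2) ^ 2 / (m : ℝ) ^ 2 *
      ∑ i, ∑ j ∈ Finset.Ioi i, ‖poleField n φ (cutoffProfile (1 / ((k : ℝ) + 1))) (p i) y -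
          poleField n φ (cutoffProfile (1 / ((k : ℝ) + 1))) (p j) y‖ ^ 2 := fun k => by
    have hY : ∀ i, Continuous (poleField n φ (cutoffProfile (1 / ((k : ℝ) + 1))) (p i)) :=
      fun i => continuous_poleField hφ (hp i) (contDiffAt_cutoffProfile (hε k))
    exact continuous_const.mul (continuous_finsetSum _ fun i _ => continuous_finsetSum _
      fun j _ => ((hY i).sub (hY j)).norm.pow 2)
  refine lintegral_le_of_tendsto_ae (f := fun (k : ℕ) y => ENNReal.ofReal
      (((n : ℝ) - 2) ^ 2 / (m : ℝ) ^ 2 * ∑ i, ∑ j ∈ Finset.Ioi i,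
        ‖poleField n φ (cutoffProfile (1 / ((k : ℝ) + 1))) (p i) y -
          poleField n φ (cutoffProfile (1 / ((k : ℝ) + 1))) (p j) y‖ ^ 2))
    (fun k => (hcont k).measurable.ennreal_ofReal.aemeasurable) ?_ (fun k => ?_)
    tendsto_const_nhds
  · filter_upwards [ae_all_iff.2 fun i => ae_ne_hemisphereVolume (by omega : 1 ≤ n) (p i)]
      with y hy
    refine tendsto_const_nhds.congr' ?_
    filter_upwards [cutoff_density_eventuallyEq p φ hy] with k hk
    rw [hk]
  -- The divergence theorem lives on the whole sphere, so the hemisphere integral is first enlarged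
  -- to it. On the right φ and ∇φ vanish off the support of φ, which brings the integrals back to
  -- the hemisphere.
  · refine (lintegral_mono' (Measure.restrict_le_self (s := upperHemisphere n)) le_rfl).trans ?_
    rw [← ofReal_integral_eq_lintegral_ofReal (integrable_of_continuous (hcont k))
      (Eventually.of_forall fun y => by positivity), ← ofReal_integral_norm_sq hL1,
      ← ofReal_integral_norm_sq hL2, ← ENNReal.ofReal_mul hκ0,
      ← ENNReal.ofReal_add (integral_nonneg fun y => sq_nonneg _)
        (mul_nonneg hκ0 (integral_nonneg fun y => sq_nonneg _))]
    refine ENNReal.ofReal_le_ofReal ?_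
    have h := integral_sum_norm_poleField_sub_sq_le hn hm hφ hp
      (contDiffAt_cutoffProfile (hε k)) (κ := (n - 1) * cotBound D) fun i y hy s hs => by
        rw [hs]
        exact cutoffProfile_ineq hn (hε k) hD
          (neg_one_lt_inner_of_mem_upperHemisphere hy (hp i)) (hpD i y hy)
    refine h.trans (le_of_eq ?_)
    rw [setIntegral_hemisphere_eq hφ (g := fun y => ‖grad n φ y‖ ^ 2) fun y hy => by
        rw [grad_eq_zero_of_eventuallyEq (notMem_tsupport_iff_eventuallyEq.1 hy)]; simp,
      setIntegral_hemisphere_eq hφ (g := fun y => φ y ^ 2) fun y hy => by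
        rw [image_eq_zero_of_notMem_tsupport hy]; simp]
    simp only [Real.norm_eq_abs, sq_abs]
    ring

theorem lintegral_hardyDensity_le_of_memSobolev {n m : ℕ} (hn : 3 ≤ n) (hm : 0 < m)
    {u : UnitSphere n → ℝ} {V : UnitSphere n → Ambient n} (hu : MemSobolev n u V)
    {p : Fin m → UnitSphere n}
    (hp : ∀ i, p i ∈ upperHemisphere n) {D : ℝ} (hD0 : 0 ≤ D) (hD : D < Real.pi)
    (hpD : ∀ i, ∀ y ∈ upperHemisphere n,
      Real.arccos (inner ℝ (y : Ambient n) (p i : Ambient n)) ≤ D) :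
    ∫⁻ y, ENNReal.ofReal (hardyDensity n p u y) ∂(hemisphereVolume n) ≤
      eLpNorm V 2 (hemisphereVolume n) ^ 2 +
        ENNReal.ofReal ((n - 1) * (n - 2) * cotBound D) *
          eLpNorm u 2 (hemisphereVolume n) ^ 2 := by
  obtain ⟨hu2, hV2, φ, hφ, hφu, hφV⟩ := hu
  set μ := hemisphereVolume n with hμ
  have hmu : ∀ k, AEStronglyMeasurable (φ k) μ := fun k =>
    (hφ k).1.continuous.aestronglyMeasurable
  have hmV : ∀ k, AEStronglyMeasurable (grad n (φ k)) μ := fun k =>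
    (continuous_grad ((hφ k).1.of_le (by simp : (1 : ℕ∞ω) ≤ ∞))).aestronglyMeasurable
  -- Convergence in L² yields almost everywhere convergence along a subsequence, which is what
  -- Fatou's lemma requires.
  obtain ⟨ns, hns, hae⟩ := (tendstoInMeasure_of_tendsto_eLpNorm two_ne_zero hmu
    hu2.aestronglyMeasurable hφu).exists_seq_tendsto_ae
  have htri : ∀ {E : Type} [NormedAddCommGroup E] {f g : UnitSphere n → E},
      AEStronglyMeasurable f μ → AEStronglyMeasurable g μ →
      eLpNorm f 2 μ ≤ eLpNorm (f - g) 2 μ + eLpNorm g 2 μ := fun {E} _ {f g} hf hg => by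
    simpa using eLpNorm_add_le (hf.sub hg) hg (p := 2) (by norm_num)
  refine lintegral_le_of_tendsto_ae
    (f := fun k y => ENNReal.ofReal (hardyDensity n p (φ (ns k)) y))
    -- The triangle inequality gives bounds that visibly converge to the norms of V and u.
    (B := fun k => (eLpNorm (grad n (φ (ns k)) - V) 2 μ + eLpNorm V 2 μ) ^ 2 +
      ENNReal.ofReal ((n - 1) * (n - 2) * cotBound D) *
        (eLpNorm (φ (ns k) - u) 2 μ + eLpNorm u 2 μ) ^ 2)
    (fun k => (aemeasurable_hardyDensity p (hmu _).aemeasurable).ennreal_ofReal) ?_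
    (fun k => ?_) ?_
  · filter_upwards [hae] with y hy
    refine (ENNReal.continuous_ofReal.tendsto _).comp ?_
    exact tendsto_const_nhds.mul (tendsto_finsetSum _ fun i _ => tendsto_finsetSum _ fun j _ =>
      tendsto_const_nhds.mul (hy.pow 2))
  · refine (lintegral_hardyDensity_le hn hm (hφ _) hp hD0 hD hpD).trans ?_
    gcongr
    · exact htri (hmV _) hV2.aestronglyMeasurable
    · exact htri (hmu _) hu2.aestronglyMeasurable
  · have h1 : Tendsto (fun k => (eLpNorm (grad n (φ (ns k)) - V) 2 μ + eLpNorm V 2 μ) ^ 2) atTop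
        (𝓝 ((0 + eLpNorm V 2 μ) ^ 2)) :=
      ((ENNReal.continuous_pow 2).tendsto _).comp
        ((hφV.comp hns.tendsto_atTop).add tendsto_const_nhds)
    have h2 : Tendsto (fun k => (eLpNorm (φ (ns k) - u) 2 μ + eLpNorm u 2 μ) ^ 2) atTop
        (𝓝 ((0 + eLpNorm u 2 μ) ^ 2)) :=
      ((ENNReal.continuous_pow 2).tendsto _).comp
        ((hφu.comp hns.tendsto_atTop).add tendsto_const_nhds)
    simpa only [zero_add] using
      h1.add (ENNReal.Tendsto.const_mul h2 (Or.inr ENNReal.ofReal_ne_top))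

end

end MultipolarHardy

/-! ### The theorem -/

theorem mainTheorem6 (n m : ℕ) (hn : 3 ≤ n) (hm : 2 ≤ m)
    (p : Fin m → MultipolarHardy.UnitSphere n) (hp : Function.Injective p)
    (hpS : ∀ i, p i ∈ MultipolarHardy.upperHemisphere n)
    (β : ℝ)
    (hβ : IsGreatest
      (Set.range fun i => MultipolarHardy.geodDist n (MultipolarHardy.northPole n) (p i)) β)
    (u : MultipolarHardy.UnitSphere n → ℝ)
    (V : MultipolarHardy.UnitSphere n → MultipolarHardy.Ambient n)
    (hu : MultipolarHardy.MemSobolev n u V) :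
    (∀ i j : Fin m, i < j →
      Integrable (fun y => MultipolarHardy.bipolarPotential n (p i) (p j) y * u y ^ 2)
        (MultipolarHardy.hemisphereVolume n)) ∧
    ((n : ℝ) - 2) ^ 2 / (m : ℝ) ^ 2 *
        ∑ i : Fin m, ∑ j ∈ Finset.Ioi i,
          ∫ y, MultipolarHardy.bipolarPotential n (p i) (p j) y * u y ^ 2
            ∂(MultipolarHardy.hemisphereVolume n) ≤
      (∫ y, ‖V y‖ ^ 2 ∂(MultipolarHardy.hemisphereVolume n)) +
        MultipolarHardy.hardyConst n β *
          ∫ y, u y ^ 2 ∂(MultipolarHardy.hemisphereVolume n) := by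
  open MultipolarHardy in
  have hn' : (3 : ℝ) ≤ n := by exact_mod_cast hn
  have hm' : (0 : ℝ) < m := by exact_mod_cast (by omega : 0 < m)
  -- The maximum is attained at a pole, which lies in the open hemisphere; hence β < π/2 strictly
  -- and the cotangent bound applies at β + π/2 < π.
  have hβ' : 0 ≤ β ∧ β < Real.pi / 2 := by
    obtain ⟨i, hi⟩ := hβ.1
    simp only [geodDist_northPole_eq (hpS i)] at hi
    rw [← hi]
    exact ⟨Real.arccos_nonneg _, arccos_inner_northPole_lt (hpS i)⟩
  have hD0 : 0 ≤ β + Real.pi / 2 := by linarith [hβ'.1, Real.pi_pos]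
  have hD : β + Real.pi / 2 < Real.pi := by linarith [hβ'.2]
  have hpD : ∀ i, ∀ y ∈ upperHemisphere n,
      Real.arccos (inner ℝ (y : Ambient n) (p i : Ambient n)) ≤ β + Real.pi / 2 := by
    intro i y hy
    have h1 : geodDist n (northPole n) (p i) ≤ β := hβ.2 ⟨i, rfl⟩
    rw [geodDist_northPole_eq (hpS i)] at h1
    linarith [arccos_inner_lt_of_mem_upperHemisphere (p := p i) hy]
  have hmain := lintegral_hardyDensity_le_of_memSobolev hn (by omega) hu hpS hD0 hD hpD
  rw [← hardyConst_eq hβ'.1 hβ'.2] at hmain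
  have hK : 0 ≤ hardyConst n β := by
    rw [hardyConst_eq hβ'.1 hβ'.2]
    exact mul_nonneg (mul_nonneg (by linarith) (by linarith)) (cotBound_nonneg hD0 hD)
  obtain ⟨hu2, hV2, -⟩ := hu
  set μ := hemisphereVolume n with hμ
  rw [← ofReal_integral_norm_sq hV2, ← ofReal_integral_norm_sq hu2, ← ENNReal.ofReal_mul hK,
    ← ENNReal.ofReal_add (integral_nonneg fun y => sq_nonneg _)
      (mul_nonneg hK (integral_nonneg fun y => sq_nonneg _))] at hmain
  simp only [Real.norm_eq_abs, sq_abs] at hmain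
  have hum : AEMeasurable u μ := hu2.aestronglyMeasurable.aemeasurable
  have hdm := aemeasurable_hardyDensity p hum
  -- Finiteness of the Sobolev norms bounds the total density. Each pair is then dominated by that
  -- density divided by the positive prefactor.
  have hdi : Integrable (hardyDensity n p u) μ := by
    refine ⟨hdm.aestronglyMeasurable, ?_⟩
    rw [hasFiniteIntegral_iff_ofReal (Eventually.of_forall (hardyDensity_nonneg p u))]
    exact hmain.trans_lt ENNReal.ofReal_lt_top
  have hc : 0 < ((n : ℝ) - 2) ^ 2 / (m : ℝ) ^ 2 := by
    have : 0 < (n : ℝ) - 2 := by linarith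
    positivity
  have hPi : ∀ i j : Fin m, i < j → Integrable
      (fun y => ‖poleVector n (p i) y - poleVector n (p j) y‖ ^ 2 * u y ^ 2) μ := by
    intro i j hij
    refine (hdi.const_mul (((n : ℝ) - 2) ^ 2 / (m : ℝ) ^ 2)⁻¹).mono'
      ((((measurable_poleVector n _).sub (measurable_poleVector n _)).norm.pow_const
        2).aemeasurable.mul (hum.pow_const 2)).aestronglyMeasurable
      (Eventually.of_forall fun y => ?_)
    rw [hardyDensity, inv_mul_cancel_left₀ hc.ne', Real.norm_of_nonneg (by positivity)]
    refine le_trans ?_ (Finset.single_le_sum (fun i _ => Finset.sum_nonneg fun j _ => by positivity)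
      (Finset.mem_univ i))
    exact Finset.single_le_sum (f := fun j =>
      ‖poleVector n (p i) y - poleVector n (p j) y‖ ^ 2 * u y ^ 2) (fun j _ => by positivity)
      (Finset.mem_Ioi.2 hij)
  have hae : ∀ i j : Fin m, (fun y => bipolarPotential n (p i) (p j) y * u y ^ 2) =ᵐ[μ]
      fun y => ‖poleVector n (p i) y - poleVector n (p j) y‖ ^ 2 * u y ^ 2 := fun i j =>
    (bipolarPotential_ae_eq (by omega) (hpS i) (hpS j)).mono fun y hy => by
      simp only [hy]
  refine ⟨fun i j hij => (hPi i j hij).congr (hae i j).symm, ?_⟩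
  have hsum : ((n : ℝ) - 2) ^ 2 / (m : ℝ) ^ 2 * ∑ i : Fin m, ∑ j ∈ Finset.Ioi i,
      ∫ y, bipolarPotential n (p i) (p j) y * u y ^ 2 ∂μ = ∫ y, hardyDensity n p u y ∂μ := by
    unfold hardyDensity
    rw [integral_const_mul, integral_finsetSum _ fun i _ => integrable_finsetSum _ fun j hj =>
      hPi i j (Finset.mem_Ioi.1 hj)]
    congr 1
    refine Finset.sum_congr rfl fun i _ => ?_
    rw [integral_finsetSum _ fun j hj => hPi i j (Finset.mem_Ioi.1 hj)]
    exact Finset.sum_congr rfl fun j _ => integral_congr_ae (hae i j)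
  rw [hsum]
  rw [← ofReal_integral_eq_lintegral_ofReal hdi
    (Eventually.of_forall (hardyDensity_nonneg p u))] at hmain
  refine (ENNReal.ofReal_le_ofReal_iff ?_).1 hmain
  exact add_nonneg (integral_nonneg fun y => sq_nonneg _)
    (mul_nonneg hK (integral_nonneg fun y => sq_nonneg _))
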